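/- **Setting.** Let $\mathbb R^\infty=\bigcup_n\mathbb R^n$ carry an inner product $Q$ (equivalently, inner products $Q_n$ on $\mathbb R^n$ with $Q_{n+1}|_{\mathbb R^n\times\mathbb R^n}=Q_n$), and let $\mathcal L=\varinjlim(\mathbb R^n)^*$ along the maps dual to the $Q$-orthogonal projections $\mathbb R^{n+1}\to\mathbb R^n$. Thus $\mathcal L=\{Q(x,\cdot):x\in\mathbb R^\infty\}$, with the inner product $Q(Q(x,\cdot),Q(y,\cdot)):=Q(x,y)$. Let $\mathcal M$ be the algebra of meromorphic germs at $0$ with linear poles and real coefficients, that is, of fractions $h(\ell_1,\dots,\ell_k)/(L_1\cdots L_n)$ with $h$ a holomorphic germ at $0\in\mathbb C^k$ with real Taylor coefficients, $\ell_i\in\mathcal L$ and $L_j\in\mathcal L\setminus\{0\}$. Let $\mathcal M_+\subset\mathcal M$ be the subalgebra of holomorphic germs ($n=0$), and let $\mathcal M_-$ be the real span of the polar germs, i.e. of those fractions with $n\ge 1$ and $Q(\ell_i,L_j)=0$ for all $i,j$. Let $\pi_+$ be the projection onto $\mathcal M_+$ along $\mathcal M_-$, and $\mathrm{ev}_0:\mathcal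 M_+\to\mathbb C$ the evaluation at $0$. Let $\mathcal M[\mathcal L]$ be the group ring with basis elements written $x^{\ell}$, $\ell\in\mathcal L$, and let $\mathrm{ev}_1:\mathcal M[\mathcal L]\to\mathcal M$, $\sum_i f_i x^{\ell_i}\mapsto\sum_i f_i$, be the evaluation at $x=1$. For $L\in\mathcal L$ let $\mathcal I^L$ be the $\mathcal M$-linear operator on $\mathcal M[\mathcal L]$ obtained by meromorphic continuation from $$\mathcal I^L(f)(x)=\int_0^\infty\frac{f(y)\,y^{-L}}{y+x}\,dy,\qquad\text{that is,}\qquad \mathcal I^L(x^{\ell})=\frac{\pi}{\sin(\pi(L-\ell))}\,x^{\ell-L}\quad(\ell\ne L).$$ A rooted forest $F$ is a finite disjoint union of rooted trees; its vertex set $V(F)$ is partially ordered with the roots as minimal elements and the leaves as maximal elements. A *properly decorated rooted forest* is a pair $(F,d)$ with $d:V(F)\to\mathcal L$ such that $Q(d(u),d(v))=0$ for all $u\ne v$ in $V(F)$, and $d(v)\neq 0$ for every leaf $v$ (so that all the integrals below are defined). Let $\mathcal R(F,d)\in\mathcal M[\mathcal L]$ be determined by $\mathcal R(1)=1$ for the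 empty forest, multiplicativity under disjoint union, and $\mathcal R(B_+^L(F,d))=\mathcal I^L(\mathcal R(F,d))$, where $B_+^L$ joins all trees of $F$ to a new root decorated by $L$. The *renormalised value* of $(F,d)$ is $$\mathcal R^{\rm ren}(F,d):=\mathrm{ev}_0\bigl(\pi_+(\mathrm{ev}_1(\mathcal R(F,d)))\bigr).$$ **Statement.** Let $(F,d_1)$ and $(F,d_2)$ be two properly decorated rooted forests with the same underlying rooted forest $F$, and suppose that they are similar: there is a constant $c>0$ such that $Q(d_1(v),d_1(v))=c\,Q(d_2(v),d_2(v))$ for every $v\in V(F)$. Then for $i=1,2$ the germ $\mathrm{ev}_1(\mathcal R(F,d_i))$ has a unique decomposition as the sum of an element of $\mathcal M_+$ and an element of $\mathcal M_-$, so that its projection under $\pi_+$ and hence $\mathcal R^{\rm ren}(F,d_i)$ are well defined, and $$\mathcal R^{\rm ren}(F,d_1)=\mathcal R^{\rm ren}(F,d_2).$$ -/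

import Mathlib

open Filter Topology

noncomputable section

namespace BranchedIntegral

/-! ### The Euclidean space `(ℝ^∞, Q)` and its linear forms -/

/-- `ℝ^∞ = ⋃ₙ ℝⁿ`: finitely supported real sequences. -/
abbrev RInf : Type := ℕ →₀ ℝ

/-- The complexification `ℝ^∞ ⊗ ℂ`. -/
abbrev CInf : Type := ℕ →₀ ℂ

/-- A sequence of inner products `Qₙ` on `ℝⁿ` with `Qₙ₊₁` extending `Qₙ` is the same thing as one
inner product on the union `ℝ^∞`. -/
structure InnerForm where
  Q : LinearMap.BilinForm ℝ RInf
  symm : ∀ x y, Q x y = Q y x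
  pos : ∀ x, x ≠ 0 → 0 < Q x x

/-! ### The one-variable integral -/

section Kernel

open Set MeasureTheory

theorem kernel_one (s : ℂ) (h0 : 0 < s.re) (h1 : s.re < 1) :
    ∫ y in Ioi (0 : ℝ), (y : ℂ) ^ (-s) / ((y : ℂ) + 1) = Real.pi / Complex.sin (Real.pi * s) := by
  have himg : (fun t : ℝ => t / (1 - t)) '' Ioo 0 1 = Ioi 0 := by
    ext y
    constructor
    · rintro ⟨t, ⟨ht0, ht1⟩, rfl⟩
      exact div_pos ht0 (by linarith)
    · intro hy
      have hy' : (0 : ℝ) < y := hy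
      refine ⟨y / (1 + y), ⟨by positivity, ?_⟩, ?_⟩
      · rw [div_lt_one (by positivity)]; linarith
      · have : (1 + y) ≠ 0 := by positivity
        field_simp
        ring
  have hder : ∀ t ∈ Ioo (0 : ℝ) 1, HasDerivWithinAt (fun t : ℝ => t / (1 - t))
      (1 / (1 - t) ^ 2) (Ioo 0 1) t := by
    intro t ht
    have hne : (1 - t) ≠ 0 := by linarith [ht.2]
    have := ((hasDerivAt_id t).div ((hasDerivAt_const t (1 : ℝ)).sub (hasDerivAt_id t)) hne)
    refine (this.congr_deriv ?_).hasDerivWithinAt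
    simp
  have hinj : InjOn (fun t : ℝ => t / (1 - t)) (Ioo 0 1) := by
    intro a ha b hb hab
    have h1 : (1 - a) ≠ 0 := by linarith [ha.2]
    have h2 : (1 - b) ≠ 0 := by linarith [hb.2]
    simp only at hab
    rw [div_eq_div_iff h1 h2] at hab
    linarith
  rw [← himg, integral_image_eq_integral_abs_deriv_smul measurableSet_Ioo hder hinj]
  have hbeta := Complex.betaIntegral_eq_Gamma_mul_div (1 - s) s (by simpa using h1) h0
  rw [sub_add_cancel, Complex.Gamma_one, div_one, mul_comm, Complex.Gamma_mul_Gamma_one_sub] at hbeta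
  rw [← hbeta, Complex.betaIntegral, intervalIntegral.integral_of_le zero_le_one,
    integral_Ioc_eq_integral_Ioo]
  refine setIntegral_congr_fun measurableSet_Ioo ?_
  intro t ht
  have ht1 : 0 < 1 - t := by linarith [ht.2]
  have hc : ((1 : ℂ) - t) ≠ 0 := by exact_mod_cast ht1.ne'
  have hpow : (((t / (1 - t) : ℝ)) : ℂ) ^ (-s) = (t : ℂ) ^ (-s) * ((1 : ℂ) - t) ^ s := by
    rw [div_eq_mul_inv, Complex.ofReal_mul, Complex.mul_cpow_ofReal_nonneg ht.1.le (by positivity)]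
    congr 1
    have := Complex.inv_cpow ((1 - t : ℝ) : ℂ) (-s)
      (by rw [Complex.arg_ofReal_of_nonneg ht1.le]; exact Real.pi_pos.ne)
    rw [Complex.ofReal_inv, this, Complex.cpow_neg, inv_inv]
    simp
  simp only [hpow]
  rw [abs_of_pos (by positivity), Complex.real_smul, Complex.cpow_sub _ _ hc, Complex.cpow_one,
    show (1 - s - 1) = -s by ring]
  push_cast
  field_simp
  ring

/-- For `0 < Re s < 1` and `x > 0`: `∫₀^∞ y^{-s} / (y + x) dy = π / sin(πs) x^{-s}`. -/
theorem kernel_integral (s : ℂ) (h0 : 0 < s.re) (h1 : s.re < 1) (x : ℝ) (hx : 0 < x) :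
    ∫ y in Ioi (0 : ℝ), (y : ℂ) ^ (-s) / ((y : ℂ) + x) =
      Real.pi / Complex.sin (Real.pi * s) * (x : ℂ) ^ (-s) := by
  have h := integral_comp_mul_left_Ioi (fun y : ℝ => (y : ℂ) ^ (-s) / ((y : ℂ) + x)) 0 hx
  rw [mul_zero] at h
  have hxc : (x : ℂ) ≠ 0 := by exact_mod_cast hx.ne'
  have h2 : ∫ y in Ioi (0 : ℝ), ((x * y : ℝ) : ℂ) ^ (-s) / (((x * y : ℝ) : ℂ) + x) =
      (x : ℂ) ^ (-s) * (x : ℂ)⁻¹ * ∫ y in Ioi (0 : ℝ), (y : ℂ) ^ (-s) / ((y : ℂ) + 1) := by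
    rw [← integral_const_mul]
    refine setIntegral_congr_fun measurableSet_Ioi ?_
    intro y hy
    have hy' : (0 : ℝ) < y := hy
    have : ((y : ℂ) + 1) ≠ 0 := by exact_mod_cast (by positivity : (y + 1 : ℝ) ≠ 0)
    have h3 : ((x : ℂ) * y + x) ≠ 0 := by exact_mod_cast (by positivity : (x * y + x : ℝ) ≠ 0)
    simp only
    rw [Complex.ofReal_mul, Complex.mul_cpow_ofReal_nonneg hx.le hy'.le]
    field_simp
  rw [h2, kernel_one s h0 h1, Complex.real_smul] at h
  have h4 := congrArg (fun w => (x : ℂ) * w) h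
  simp only [Complex.ofReal_inv] at h4
  rw [mul_inv_cancel_left₀ hxc] at h4
  rw [← h4]
  field_simp

end Kernel

namespace InnerForm

variable (E : InnerForm)

theorem Q_injective : Function.Injective E.Q := by
  refine (injective_iff_map_eq_zero E.Q).2 fun x hx => ?_
  by_contra h
  have := E.pos x h
  rw [hx] at this
  simp at this

/-- The space `ℒ = lim (ℝⁿ)^*` of linear forms. The transition maps `(ℝⁿ)^* → (ℝⁿ⁺¹)^*` are dual to
the `Q`-orthogonal projections `ℝⁿ⁺¹ → ℝⁿ`, so they send `Q(x, ·)` on `ℝⁿ` to `Q(x, ·)` on `ℝⁿ⁺¹`.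
Hence the limit is the space of all forms `Q(x, ·)` on `ℝ^∞`, with `x ∈ ℝ^∞`. -/
def Forms : Type := ↥(LinearMap.range E.Q)

instance instAddCommGroupForms : AddCommGroup E.Forms :=
  inferInstanceAs (AddCommGroup ↥(LinearMap.range E.Q))

instance instModuleForms : Module ℝ E.Forms :=
  inferInstanceAs (Module ℝ ↥(LinearMap.range E.Q))

/-- An element of `ℒ` as a linear form on `ℝ^∞`. -/
def toDual : E.Forms →ₗ[ℝ] Module.Dual ℝ RInf := (LinearMap.range E.Q).subtype

/-- The vector `x` with `ℓ = Q(x, ·)`. -/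
def dualVec : E.Forms ≃ₗ[ℝ] RInf := (LinearEquiv.ofInjective E.Q E.Q_injective).symm

/-- The inner product on linear forms: `Q(Q(x, ·), Q(y, ·)) = Q(x, y)`. -/
def formQ (ℓ m : E.Forms) : ℝ := E.Q (E.dualVec ℓ) (E.dualVec m)

/-- The value of a real linear form at a complex point, by `ℂ`-linear extension. -/
def cval (ℓ : E.Forms) : CInf →ₗ[ℂ] ℂ :=
  Finsupp.linearCombination ℂ fun i => ((E.toDual ℓ (Finsupp.single i 1) : ℝ) : ℂ)

/-! ### Holomorphic germs -/

/-- The neighbourhoods of `0` in `ℝ^∞ ⊗ ℂ` used for germs: the preimages of neighbourhoods of `0`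
in the `ℂⁿ` under the orthogonal projections `ℝ^∞ ⊗ ℂ → ℂⁿ`; equivalently, those of the initial
topology of all linear forms in `ℒ`. -/
def nhd : Filter CInf := ⨅ ℓ : E.Forms, comap (E.cval ℓ) (𝓝 0)

theorem pure_le_nhd : pure 0 ≤ E.nhd := by
  refine le_iInf fun ℓ => ?_
  rw [← map_le_iff_le_comap, map_pure, map_zero]
  exact pure_le_nhds 0

instance instAlgebraGerm : Algebra ℝ (Germ E.nhd ℂ) :=
  Algebra.ofModule
    (by
      intro r x y
      induction x using Germ.inductionOn with | _ f
      induction y using Germ.inductionOn with | _ g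
      rw [← Germ.coe_smul, ← Germ.coe_mul, ← Germ.coe_mul, ← Germ.coe_smul, smul_mul_assoc])
    (by
      intro r x y
      induction x using Germ.inductionOn with | _ f
      induction y using Germ.inductionOn with | _ g
      rw [← Germ.coe_smul, ← Germ.coe_mul, ← Germ.coe_mul, ← Germ.coe_smul, mul_smul_comm])

/-- The Taylor coefficients of `h` at `0` are real. -/
def HasRealCoeffs {k : ℕ} (h : (Fin k → ℂ) → ℂ) : Prop :=
  ∀ᶠ z in 𝓝 (0 : Fin k → ℂ), h (star z) = star (h z)

/-- The germ of `h(ℓ₁, …, ℓₖ)` at `0`. -/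
def compGerm {k : ℕ} (h : (Fin k → ℂ) → ℂ) (ℓ : Fin k → E.Forms) : Germ E.nhd ℂ :=
  ((fun z => h fun i => E.cval (ℓ i) z : CInf → ℂ) : Germ E.nhd ℂ)

/-- `g` is the germ of `h(ℓ₁, …, ℓₖ)` with `h` holomorphic at `0 ∈ ℂᵏ` with real coefficients, and
each of the linear forms `ℓᵢ` satisfying `P`. -/
def IsHolIn (P : E.Forms → Prop) (g : Germ E.nhd ℂ) : Prop :=
  ∃ (k : ℕ) (h : (Fin k → ℂ) → ℂ) (ℓ : Fin k → E.Forms),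
    AnalyticAt ℂ h 0 ∧ HasRealCoeffs h ∧ (∀ i, P (ℓ i)) ∧ g = E.compGerm h ℓ

theorem IsHolIn.map₂ {P : E.Forms → Prop} {g₁ g₂ : Germ E.nhd ℂ} (h₁ : E.IsHolIn P g₁)
    (h₂ : E.IsHolIn P g₂) (op : ℂ → ℂ → ℂ)
    (hop : ∀ p, AnalyticAt ℂ (fun q : ℂ × ℂ => op q.1 q.2) p)
    (hstar : ∀ a b, op (star a) (star b) = star (op a b)) : E.IsHolIn P (Germ.map₂ op g₁ g₂) := by
  obtain ⟨k₁, u₁, ℓ₁, ha₁, hr₁, hP₁, rfl⟩ := h₁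
  obtain ⟨k₂, u₂, ℓ₂, ha₂, hr₂, hP₂, rfl⟩ := h₂
  let p₁ : (Fin (k₁ + k₂) → ℂ) →L[ℂ] (Fin k₁ → ℂ) :=
    ContinuousLinearMap.pi fun i => ContinuousLinearMap.proj (Fin.castAdd k₂ i)
  let p₂ : (Fin (k₁ + k₂) → ℂ) →L[ℂ] (Fin k₂ → ℂ) :=
    ContinuousLinearMap.pi fun i => ContinuousLinearMap.proj (Fin.natAdd k₁ i)
  have t₁ : Tendsto p₁ (𝓝 0) (𝓝 0) := by simpa using p₁.continuous.tendsto 0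
  have t₂ : Tendsto p₂ (𝓝 0) (𝓝 0) := by simpa using p₂.continuous.tendsto 0
  refine ⟨k₁ + k₂, fun z => op (u₁ (p₁ z)) (u₂ (p₂ z)), Fin.append ℓ₁ ℓ₂, ?_, ?_, ?_, ?_⟩
  · have b₁ : AnalyticAt ℂ (fun z => u₁ (p₁ z)) 0 :=
      AnalyticAt.fun_comp (by simpa using ha₁) (p₁.analyticAt 0)
    have b₂ : AnalyticAt ℂ (fun z => u₂ (p₂ z)) 0 :=
      AnalyticAt.fun_comp (by simpa using ha₂) (p₂.analyticAt 0)
    exact AnalyticAt.fun_comp (g := fun q : ℂ × ℂ => op q.1 q.2) (hop _) (b₁.prod b₂)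
  · filter_upwards [t₁.eventually hr₁, t₂.eventually hr₂] with z e₁ e₂
    have s₁ : p₁ (star z) = star (p₁ z) := rfl
    have s₂ : p₂ (star z) = star (p₂ z) := rfl
    rw [s₁, s₂, e₁, e₂, hstar]
  · intro i
    refine Fin.addCases (fun j => ?_) (fun j => ?_) i
    · simpa using hP₁ j
    · simpa using hP₂ j
  · have e₁ : ∀ z : CInf, p₁ (fun i => E.cval (Fin.append ℓ₁ ℓ₂ i) z) =
        fun i => E.cval (ℓ₁ i) z := fun z => by
      funext i; simp [p₁]
    have e₂ : ∀ z : CInf, p₂ (fun i => E.cval (Fin.append ℓ₁ ℓ₂ i) z) =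
        fun i => E.cval (ℓ₂ i) z := fun z => by
      funext i; simp [p₂]
    simp only [compGerm, e₁, e₂]
    rfl

/-- The algebra `ℳ₊` of holomorphic germs at `0` with real coefficients. -/
def Hol : Subalgebra ℝ (Germ E.nhd ℂ) where
  carrier := {g | E.IsHolIn (fun _ => True) g}
  add_mem' h₁ h₂ := IsHolIn.map₂ E (P := fun _ => True) h₁ h₂ (· + ·)
    (fun _ => analyticAt_fst.add analyticAt_snd) fun a b => (star_add a b).symm
  mul_mem' h₁ h₂ := IsHolIn.map₂ E (P := fun _ => True) h₁ h₂ (· * ·)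
    (fun _ => analyticAt_fst.mul analyticAt_snd) fun a b => by simp
  algebraMap_mem' r := ⟨0, fun _ => (r : ℂ), fun i => i.elim0, analyticAt_const,
    Eventually.of_forall fun _ => by simp, fun i => i.elim0, by
      rw [Algebra.algebraMap_eq_smul_one]
      change ((r • (1 : CInf → ℂ) : CInf → ℂ) : Germ E.nhd ℂ) = _
      congr 1
      funext z
      simp⟩

theorem uni_mem (u : ℂ → ℂ) (ha : AnalyticAt ℂ u 0) (hr : ∀ z, u (star z) = star (u z))
    (ℓ : E.Forms) : ((fun z => u (E.cval ℓ z) : CInf → ℂ) : Germ E.nhd ℂ) ∈ E.Hol :=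
  ⟨1, fun w => u (w 0), fun _ => ℓ,
    AnalyticAt.fun_comp (g := u) (f := fun w : Fin 1 → ℂ => w 0) ha
      ((ContinuousLinearMap.proj (R := ℂ) (φ := fun _ : Fin 1 => ℂ) 0).analyticAt 0),
    Eventually.of_forall fun z => hr (z 0), fun _ => trivial, rfl⟩

/-- A linear form as a holomorphic germ. -/
def formGerm (ℓ : E.Forms) : E.Hol :=
  ⟨((fun z => E.cval ℓ z : CInf → ℂ) : Germ E.nhd ℂ),
    E.uni_mem (fun s => s) analyticAt_id (fun _ => rfl) ℓ⟩

/-- The germ of `sin(πℓ)`. -/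
def sinGerm (ℓ : E.Forms) : E.Hol :=
  ⟨((fun z => Complex.sin (Real.pi * E.cval ℓ z) : CInf → ℂ) : Germ E.nhd ℂ),
    E.uni_mem (fun s => Complex.sin (Real.pi * s))
      (by fun_prop)
      (fun z => by
        have : (Real.pi : ℂ) * star z = star (Real.pi * z) := by simp
        rw [this]
        exact Complex.sin_conj _) ℓ⟩

/-- Evaluation of a holomorphic germ at `0`. -/
def evZero (g : E.Hol) : ℂ :=
  Quotient.liftOn' g.1 (fun f => f 0) fun _ _ h => (E.pure_le_nhd h : _)

/-! ### Meromorphic germs with linear poles -/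

/-- The denominators: products of nonzero linear forms. -/
def poles : Submonoid E.Hol := Submonoid.closure {g | ∃ L : E.Forms, L ≠ 0 ∧ g = E.formGerm L}

theorem prod_mem_poles {n : ℕ} {L : Fin n → E.Forms} (hL : ∀ j, L j ≠ 0) :
    ∏ j, E.formGerm (L j) ∈ E.poles :=
  Submonoid.prod_mem _ fun j _ => Submonoid.subset_closure ⟨L j, hL j, rfl⟩

/-- The algebra `ℳ` of meromorphic germs at `0` with linear poles and real coefficients: fractions
of a holomorphic germ by a product of nonzero linear forms. -/
abbrev Mer : Type := Localization E.poles

/-- Polar germs: `h(ℓ₁, …, ℓₖ) / (L₁ ⋯ Lₙ)` with `n ≥ 1`, where `h` is a holomorphic germ and every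
`ℓᵢ` is orthogonal to every `Lⱼ`. -/
def IsPolar (f : E.Mer) : Prop :=
  ∃ (n : ℕ) (L : Fin n → E.Forms) (hL : ∀ j, L j ≠ 0) (g : E.Hol), 0 < n ∧
    E.IsHolIn (fun ℓ => ∀ j, E.formQ ℓ (L j) = 0) g.1 ∧
    f = Localization.mk g ⟨∏ j, E.formGerm (L j), E.prod_mem_poles hL⟩

/-- The space `ℳ₋` spanned by the polar germs. -/
def Polar : Submodule ℝ E.Mer := Submodule.span ℝ {f | E.IsPolar f}

/-- `g` is the holomorphic component of `f` in the decomposition `ℳ = ℳ₊ ⊕ ℳ₋`. -/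
def IsHolPart (f : E.Mer) (g : E.Hol) : Prop := f - algebraMap E.Hol E.Mer g ∈ E.Polar

/-- The projection `π₊` onto `ℳ₊` along `ℳ₋`. -/
def piPlus (f : E.Mer) : E.Hol := Classical.epsilon (E.IsHolPart f)

/-! ### The operators `I^L` on `ℳ[ℒ]` -/

/-- The group ring `ℳ[ℒ]`, whose basis element at `ℓ ∈ ℒ` stands for `x^ℓ`. -/
abbrev MerPow : Type := AddMonoidAlgebra E.Mer E.Forms

/-- The meromorphic germ `π / sin(πℓ)`, for `ℓ ≠ 0`. -/
def piDivSin (ℓ : E.Forms) : E.Mer :=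
  Real.pi • Ring.inverse (algebraMap E.Hol E.Mer (E.sinGerm ℓ))

/-- The `ℳ`-linear operator `I^L(f)(x) = ∫₀^∞ f(y) y^{-L} / (y + x) dy`. By `kernel_integral` with
`s = (L - ℓ)(z)`, it sends `x^ℓ` to `π / sin(π(L - ℓ)) x^{ℓ - L}` at all points `z` at which the
integral converges, and it is extended meromorphically from there to a neighbourhood of `0`. -/
def intOp (L : E.Forms) (f : E.MerPow) : E.MerPow :=
  f.coeff.sum fun ℓ a => AddMonoidAlgebra.single (ℓ - L) (a * E.piDivSin (L - ℓ))

/-- Evaluation at `x = 1`, i.e. `f x^ℓ ↦ f`. -/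
def evOne (f : E.MerPow) : E.Mer := f.coeff.sum fun _ a => a

end InnerForm

/-! ### Decorated rooted forests -/

/-- A finite partial order is the vertex order of a rooted forest, with roots at the bottom, iff the
vertices below any given vertex form a chain. -/
def IsRootedForest (V : Type*) [PartialOrder V] : Prop :=
  ∀ v a b : V, a ≤ v → b ≤ v → a ≤ b ∨ b ≤ a

namespace InnerForm

variable (E : InnerForm) {V : Type*} [Fintype V] [PartialOrder V]

/-- Properly decorated: the decorations of distinct vertices are orthogonal. The leaves (maximal
vertices) carry nonzero decorations: otherwise `I^0(1)` would occur, which is not defined. -/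
structure IsProperlyDecorated (d : V → E.Forms) : Prop where
  orthogonal : ∀ u v, u ≠ v → E.formQ (d u) (d v) = 0
  leaf_ne_zero : ∀ v, IsMax v → d v ≠ 0

/-- Similarity of two decorations of the same rooted forest. -/
def Similar (d₁ d₂ : V → E.Forms) : Prop :=
  ∃ c : ℝ, 0 < c ∧ ∀ v, E.formQ (d₁ v) (d₁ v) = c * E.formQ (d₂ v) (d₂ v)

open Classical in
/-- The value of `ℛ` on the subtree `F_v` with root `v`. This tree is the grafting with root
decoration `d v` of the product of the subtrees of the children `w` of `v`. -/
def treeR (d : V → E.Forms) (v : V) : E.MerPow :=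
  E.intOp (d v) (∏ w : {w : V // v ⋖ w}, treeR d w.1)
termination_by wellFounded_gt.wrap v
decreasing_by exact w.2.lt

open Classical in
/-- The morphism of operated algebras `ℛ`: `ℛ(1) = 1`, `ℛ` is multiplicative, and
`ℛ(B₊^L(F, d)) = I^L(ℛ(F, d))`. So its value on a forest is the product over its trees, which are
the subtrees of the roots. -/
def forestR (d : V → E.Forms) : E.MerPow := ∏ r : {r : V // IsMin r}, E.treeR d r.1

/-- `ℛ₁ = ev₁ ∘ ℛ`. -/
def forestR₁ (d : V → E.Forms) : E.Mer := E.evOne (E.forestR d)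

/-- The renormalised value `ℛ^ren = ev₀ ∘ π₊ ∘ ℛ₁`. -/
def renormalised (d : V → E.Forms) : ℂ := E.evZero (E.piPlus (E.forestR₁ d))

end InnerForm

end BranchedIntegral

end

/-!
Both halves of the theorem rest on the decomposition `ℳ = ℳ₊ ⊕ ℳ₋`, which holds for all of `ℳ`.

*Existence* (`exists_isHolPart`). Let `f = g / (L₁ ⋯ Lₙ)`, and let `W` be the span of the `Lⱼ`.
Restricting `g` to the orthogonal complement of `W` gives the numerator `g₀` of a polar germ. By
Hadamard's lemma (`exists_sub_pull_projPerp_eq`) the difference `g - g₀` lies in the ideal generated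
by `W`, that is, by the `Lⱼ`. So `f - g₀ / (L₁ ⋯ Lₙ)` is a sum of fractions with fewer poles.

*Uniqueness* (`eq_zero_of_algebraMap_mem_polar`). Polar germs are sorted by the span `W` of their
denominators. The spaces `polarAlong W` so obtained, of which `W = 0` gives the holomorphic germs,
are independent (`eq_zero_of_sum_eq_zero`). Indeed, along a hyperplane `L = 0` only the spaces with
`L ∈ W` have poles, and the coefficients of the principal part of an element of `polarAlong W` are in
`polarAlong (W ∩ L^⊥)` (`polarAlong_le_expandable`). If a sum of elements of different spaces
vanishes, its principal parts vanish, and by induction on the dimension so do those of each summand.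
A summand without poles is holomorphic (`exists_eq_algebraMap_of_regularAlong`). But contraction by
`1 / 2` along `W ≠ 0` multiplies the terms of an element of `polarAlong W` by powers `2 ^ n` with
`n ≥ 1`, while it has no such eigenvalue on holomorphic germs (`eq_zero_of_pull_dilation_eq`).

*Invariance.* For similar decorations there is a similitude `τ` of `ℒ` with `τ (d₂ v) = d₁ v` for
all `v`; it is a product of reflections times a scalar (`exists_isometry_apply_eq`). Substituting
`τ ℓ` for `ℓ` is an automorphism of `ℳ` that commutes with the construction of `ℛ`
(`pullMer_forestR₁`), preserves `ℳ₊` and `ℳ₋`, hence `π₊`, and does not change values at `0`.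
-/

noncomputable section

namespace BranchedIntegral

/-! ### Division of power series by a linear form -/

section Hadamard

variable {E E' : Type*} [NormedAddCommGroup E] [NormedSpace ℂ E] [NormedAddCommGroup E']
  [NormedSpace ℂ E']

/-- The power series of `(h ∘ A - h ∘ B) / φ`, where `p` is the power series of `h` and
`A v - B v = φ v • c`: in degree `n` it is the sum over the positions `i` of
`p (A v, …, A v, c, B v, …, B v)` with `c` in position `i`. -/
def quotSeries (p : FormalMultilinearSeries ℂ E ℂ) (A B : E' →L[ℂ] E) (c : E) :
    FormalMultilinearSeries ℂ E' ℂ := fun n =>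
  ∑ i : Fin (n + 1), (ContinuousMultilinearMap.curryMid i (p (n + 1)) c).compContinuousLinearMap
    fun j => if i.succAbove j < i then A else B

theorem mul_quotSeries_apply (p : FormalMultilinearSeries ℂ E ℂ) (A B : E' →L[ℂ] E) (c : E)
    (n : ℕ) (v : E') (t : ℂ) (hv : A v - B v = t • c) :
    t * quotSeries p A B c n (fun _ => v) =
      p (n + 1) (fun _ => A v) - p (n + 1) (fun _ => B v) := by
  -- The sum telescopes, the arguments being switched from `B v` to `A v` one by one.
  let U : ℕ → Fin (n + 1) → E := fun k j => if (j : ℕ) < k then A v else B v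
  have key : ∀ i : Fin (n + 1), t * ((ContinuousMultilinearMap.curryMid i (p (n + 1)) c)
      (fun j => (if i.succAbove j < i then A else B) v)) =
      p (n + 1) (U (i + 1)) - p (n + 1) (U i) := by
    intro i
    have h1 : U (i + 1) = i.insertNth (α := fun _ => E) (A v)
        (fun j => (if i.succAbove j < i then A else B) v) := by
      funext j
      refine Fin.succAboveCases i ?_ (fun j => ?_) j
      · simp [U]
      · have : ((i.succAbove j : ℕ) < i + 1) ↔ i.succAbove j < i := by
          have := Fin.succAbove_ne i j
          rw [Fin.lt_def]
          have h3 : (i.succAbove j : ℕ) ≠ i := fun h => this (Fin.ext h)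
          omega
        simp only [U, this, Fin.insertNth_apply_succAbove]
        split_ifs <;> rfl
    have h2 : U i = i.insertNth (α := fun _ => E) (B v)
        (fun j => (if i.succAbove j < i then A else B) v) := by
      funext j
      refine Fin.succAboveCases i ?_ (fun j => ?_) j
      · simp [U]
      · simp only [U, ← Fin.lt_def, Fin.insertNth_apply_succAbove]
        split_ifs <;> rfl
    rw [h1, h2, ← ContinuousMultilinearMap.curryMid_apply, ← ContinuousMultilinearMap.curryMid_apply,
      ← sub_apply, ← map_sub, hv, map_smul,
      smul_apply, smul_eq_mul]
  simp only [quotSeries, sum_apply, Finset.mul_sum,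
    ContinuousMultilinearMap.compContinuousLinearMap_apply]
  rw [Finset.sum_congr rfl fun i _ => key i,
    Fin.sum_univ_eq_sum_range (fun k => p (n + 1) (U (k + 1)) - p (n + 1) (U k)),
    Finset.sum_range_sub (fun k => p (n + 1) (U k))]
  congr 2
  funext j
  simp only [U, if_pos j.isLt]

theorem quotSeries_radius_pos (p : FormalMultilinearSeries ℂ E ℂ) (A B : E' →L[ℂ] E) (c : E)
    (hp : 0 < p.radius) : 0 < (quotSeries p A B c).radius := by
  obtain ⟨r, hr0, hr⟩ := ENNReal.lt_iff_exists_nnreal_btwn.1 hp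
  have hr0' : 0 < r := by exact_mod_cast hr0
  obtain ⟨C, hC, hpn⟩ := p.norm_le_div_pow_of_pos_of_lt_radius hr0' hr
  let M : NNReal := 1 + ‖A‖₊ + ‖B‖₊
  have hM : 0 < M := by positivity
  have hMr : (0 : ℝ) < M := by exact_mod_cast hM
  have hrr : (0 : ℝ) < r := by exact_mod_cast hr0'
  -- Each of the `n + 1 ≤ 2 ^ n` summands is at most `C / r ^ (n + 1) * ‖c‖ * M ^ n`.
  have hbound : ((r / (2 * M) : NNReal) : ENNReal) ≤ (quotSeries p A B c).radius := by
    refine FormalMultilinearSeries.le_radius_of_bound _ (C / r * ‖c‖) fun n => ?_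
    have h1 : ‖quotSeries p A B c n‖ ≤ (n + 1) * (C / r ^ (n + 1) * ‖c‖ * M ^ n) := by
      refine (norm_sum_le _ _).trans ?_
      refine (Finset.sum_le_card_nsmul _ _ (C / r ^ (n + 1) * ‖c‖ * M ^ n) fun i _ => ?_).trans
        (le_of_eq (by simp))
      refine (ContinuousMultilinearMap.norm_compContinuousLinearMap_le _ _).trans ?_
      refine mul_le_mul ?_ ?_ (Finset.prod_nonneg fun _ _ => norm_nonneg _) (by positivity)
      · refine (ContinuousLinearMap.le_opNorm _ _).trans ?_
        rw [ContinuousMultilinearMap.norm_curryMid]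
        exact mul_le_mul_of_nonneg_right (hpn _) (norm_nonneg _)
      · refine (Finset.prod_le_prod (g := fun _ => (M : ℝ)) (fun _ _ => norm_nonneg _)
          fun j _ => ?_).trans (le_of_eq (by simp))
        have hA := norm_nonneg A
        have hB := norm_nonneg B
        simp only [M, NNReal.coe_add, NNReal.coe_one, coe_nnnorm]
        split_ifs <;> linarith
    have h2 : ((n : ℝ) + 1) ≤ 2 ^ n := by exact_mod_cast Nat.lt_two_pow_self
    calc ‖quotSeries p A B c n‖ * ((r / (2 * M) : NNReal) : ℝ) ^ n
        ≤ (2 ^ n * (C / r ^ (n + 1) * ‖c‖ * M ^ n)) * ((r / (2 * M) : NNReal) : ℝ) ^ n := by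
          gcongr
          exact h1.trans (by gcongr)
      _ = C / r * ‖c‖ := by
          push_cast
          rw [div_pow, mul_pow]
          field_simp
          ring
  exact lt_of_lt_of_le (by exact_mod_cast (by positivity)) hbound

/-- Hadamard's lemma: if `A v - B v` is `φ v` times a fixed vector, then `h ∘ A - h ∘ B` is
divisible by the linear form `φ`. -/
theorem exists_analyticAt_quot {h : E → ℂ} (hh : AnalyticAt ℂ h 0) (A B : E' →L[ℂ] E) (c : E)
    (φ : E' → ℂ) (hAB : ∀ v, A v - B v = φ v • c) :
    ∃ G : E' → ℂ, AnalyticAt ℂ G 0 ∧ ∀ᶠ v in 𝓝 0, h (A v) - h (B v) = φ v * G v := by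
  obtain ⟨p, r, hp⟩ := hh
  have hrad : 0 < p.radius := lt_of_lt_of_le hp.r_pos hp.r_le
  have hq := quotSeries_radius_pos p A B c hrad
  have hG := (quotSeries p A B c).hasFPowerSeriesOnBall hq
  refine ⟨_, hG.analyticAt, ?_⟩
  have tA : Tendsto A (𝓝 0) (𝓝 0) := by simpa using A.continuous.tendsto 0
  have tB : Tendsto B (𝓝 0) (𝓝 0) := by simpa using B.continuous.tendsto 0
  have hball := Metric.eball_mem_nhds (0 : E) hp.r_pos
  filter_upwards [tA hball, tB hball, Metric.eball_mem_nhds (0 : E') hq] with v hA hB hv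
  have sA := hp.hasSum hA
  have sB := hp.hasSum hB
  have sG := (hG.hasSum hv).mul_left (φ v)
  simp only [zero_add] at sA sB sG
  have s := sA.sub sB
  rw [← hasSum_nat_add_iff' 1] at s
  simp only [mul_quotSeries_apply p A B c _ v (φ v) (hAB v)] at sG
  have := s.unique sG
  rw [← this]
  have e : p 0 (fun _ => A v) = p 0 (fun _ => B v) := by congr 1; exact Subsingleton.elim _ _
  simp [e]

end Hadamard

namespace InnerForm

variable (E : InnerForm)

/-! ### The inner product space of linear forms -/

/-- The inner product on `ℒ`, as the core of an inner product space. -/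
abbrev formsCore : InnerProductSpace.Core ℝ E.Forms where
  inner x y := E.formQ x y
  conj_inner_symm x y := E.symm _ _
  re_inner_nonneg x := by
    by_cases h : E.dualVec x = 0
    · simp [formQ, h]
    · exact (E.pos _ h).le
  add_left x y z := by simp [formQ]
  smul_left x y r := by simp [formQ]
  definite x hx := by
    by_contra h
    exact (E.pos (E.dualVec x) (by simpa using h)).ne' hx

instance instNormedAddCommGroupForms : NormedAddCommGroup E.Forms :=
  @InnerProductSpace.Core.toNormedAddCommGroup ℝ E.Forms _ _ _ E.formsCore

instance instInnerProductSpaceForms : InnerProductSpace ℝ E.Forms :=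
  InnerProductSpace.ofCore E.formsCore.toCore

theorem inner_eq_formQ (x y : E.Forms) : inner ℝ x y = E.formQ x y := rfl

theorem toDual_eq_Q (ℓ : E.Forms) (x : RInf) : E.toDual ℓ x = E.Q (E.dualVec ℓ) x := by
  have h := (LinearEquiv.ofInjective E.Q E.Q_injective).apply_symm_apply ℓ
  have h2 := congrArg Subtype.val h
  rw [LinearEquiv.ofInjective_apply] at h2
  change (Subtype.val ℓ : Module.Dual ℝ RInf) x = _
  rw [← h2]
  rfl

theorem toDual_eq_formQ (ℓ : E.Forms) (x : RInf) :
    E.toDual ℓ x = E.formQ ℓ (E.dualVec.symm x) := by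
  rw [toDual_eq_Q, formQ, LinearEquiv.apply_symm_apply]

/-! ### Values of linear forms at complex points -/

theorem cval_add (ℓ m : E.Forms) (z : CInf) : E.cval (ℓ + m) z = E.cval ℓ z + E.cval m z := by
  simp only [cval, Finsupp.linearCombination_apply, Finsupp.sum, map_add, LinearMap.add_apply,
    Complex.ofReal_add, smul_add, Finset.sum_add_distrib]

theorem cval_smul (r : ℝ) (ℓ : E.Forms) (z : CInf) : E.cval (r • ℓ) z = r * E.cval ℓ z := by
  simp only [cval, Finsupp.linearCombination_apply, Finsupp.sum, map_smul, LinearMap.smul_apply,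
    smul_eq_mul, Complex.ofReal_mul, Finset.mul_sum]
  exact Finset.sum_congr rfl fun i _ => by ring

theorem cval_single (ℓ : E.Forms) (i : ℕ) (c : ℂ) :
    E.cval ℓ (Finsupp.single i c) = c * (E.toDual ℓ (Finsupp.single i 1) : ℝ) := by
  simp [cval]

theorem eq_zero_of_cval {ℓ : E.Forms} (h : ∀ z, E.cval ℓ z = 0) : ℓ = 0 := by
  have h1 : E.toDual ℓ = 0 := by
    refine Finsupp.lhom_ext' fun i => LinearMap.ext_ring ?_
    have := h (Finsupp.single i 1)
    rw [cval_single, one_mul] at this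
    simpa using this
  exact Subtype.ext h1

/-- The complexification of a vector of `ℝ^∞`. -/
def complexify (x : RInf) : CInf := x.mapRange (fun r : ℝ => (r : ℂ)) Complex.ofReal_zero

theorem cval_complexify (ℓ : E.Forms) (x : RInf) : E.cval ℓ (complexify x) = E.toDual ℓ x := by
  induction x using Finsupp.induction_linear with
  | zero => simp [complexify]
  | add x y hx hy =>
    have : complexify (x + y) = complexify x + complexify y := by
      ext i; simp [complexify]
    rw [this, map_add, hx, hy, map_add, Complex.ofReal_add]
  | single i r =>
    rw [complexify, Finsupp.mapRange_single, cval_single,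
      show Finsupp.single i r = r • Finsupp.single i (1 : ℝ) by simp, map_smul]
    simp

/-! ### The neighbourhood filter -/

theorem tendsto_cval (ℓ : E.Forms) : Tendsto (E.cval ℓ) E.nhd (𝓝 0) :=
  (tendsto_comap.mono_left (iInf_le _ ℓ))

theorem tendsto_cval_pi {k : ℕ} (ℓ : Fin k → E.Forms) :
    Tendsto (fun z i => E.cval (ℓ i) z) E.nhd (𝓝 0) :=
  tendsto_pi_nhds.2 fun i => E.tendsto_cval (ℓ i)

theorem tendsto_nhd {α : Type*} {l : Filter α} {f : α → CInf}
    (h : ∀ ℓ, Tendsto (fun a => E.cval ℓ (f a)) l (𝓝 0)) : Tendsto f l E.nhd :=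
  tendsto_iInf.2 fun ℓ => tendsto_comap_iff.2 (h ℓ)

theorem tendsto_line (z : CInf) : Tendsto (fun t : ℂ => t • z) (𝓝 0) E.nhd := by
  refine E.tendsto_nhd fun ℓ => ?_
  have : Continuous fun t : ℂ => E.cval ℓ (t • z) := by
    simp only [map_smul, smul_eq_mul]
    fun_prop
  simpa using this.tendsto 0

theorem exists_finset_of_mem_nhd {U : Set CInf} (hU : U ∈ E.nhd) :
    ∃ (t : Finset E.Forms) (ε : ℝ), 0 < ε ∧ {z | ∀ ℓ ∈ t, ‖E.cval ℓ z‖ < ε} ⊆ U := by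
  classical
  rw [nhd, mem_iInf_finite] at hU
  obtain ⟨t, ht⟩ := hU
  refine ⟨t, ?_⟩
  induction t using Finset.induction_on generalizing U with
  | empty => exact ⟨1, one_pos, fun z _ => by simp_all⟩
  | insert a t _ ih =>
    rw [Finset.iInf_insert] at ht
    obtain ⟨U₁, h₁, U₂, h₂, rfl⟩ := mem_inf_iff.1 ht
    obtain ⟨ε₂, hε₂, h₂⟩ := ih h₂
    obtain ⟨ε₁, hε₁, h₁⟩ := (Metric.nhds_basis_ball.comap _).mem_iff.1 h₁
    refine ⟨min ε₁ ε₂, lt_min hε₁ hε₂, fun z hz => ⟨h₁ ?_, h₂ ?_⟩⟩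
    · simpa using (hz a (Finset.mem_insert_self _ _)).trans_le (min_le_left _ _)
    · exact fun ℓ hℓ => (hz ℓ (Finset.mem_insert_of_mem hℓ)).trans_le (min_le_right _ _)

/-! ### The identity theorem for germs -/

/-- The identity theorem: a holomorphic germ that vanishes near `0` vanishes on every domain given
by a ball on which its representative is analytic. -/
theorem eq_zero_of_compGerm_eq_zero {k : ℕ} {h : (Fin k → ℂ) → ℂ} {ℓ : Fin k → E.Forms} {r : ℝ}
    (hr : 0 < r) (hh : AnalyticOnNhd ℂ h (Metric.ball 0 r)) (h0 : E.compGerm h ℓ = 0) (z : CInf)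
    (hz : (fun i => E.cval (ℓ i) z) ∈ Metric.ball (0 : Fin k → ℂ) r) :
    h (fun i => E.cval (ℓ i) z) = 0 := by
  set w : Fin k → ℂ := fun i => E.cval (ℓ i) z with hw
  let γ : ℂ →L[ℂ] (Fin k → ℂ) := (ContinuousLinearMap.id ℂ ℂ).smulRight w
  have hU : IsPreconnected (γ ⁻¹' Metric.ball 0 r) :=
    ((convex_ball (0 : Fin k → ℂ) r).linear_preimage (γ.restrictScalars ℝ).toLinearMap).isPreconnected
  have han : AnalyticOnNhd ℂ (fun t => h (γ t)) (γ ⁻¹' Metric.ball 0 r) := fun t ht =>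
    AnalyticAt.fun_comp (hh _ ht) (γ.analyticAt t)
  have hev : (fun t => h (γ t)) =ᶠ[𝓝 0] 0 := by
    have h1 : ∀ᶠ z in E.nhd, h (fun i => E.cval (ℓ i) z) = 0 := Germ.coe_eq.1 h0
    filter_upwards [(E.tendsto_line z).eventually h1] with t ht
    refine Eq.trans ?_ ht
    simp only [map_smul]
    rfl
  have := han.eqOn_zero_of_preconnected_of_eventuallyEq_zero hU (by simpa using hr) hev
    (x := 1) (by simpa [γ] using hz)
  simpa [γ] using this

/-- Two holomorphic germs are functions of the same linear forms. -/
theorem exists_common_rep (g₁ g₂ : E.Hol) : ∃ (k : ℕ) (u₁ u₂ : (Fin k → ℂ) → ℂ)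
    (ℓ : Fin k → E.Forms) (r : ℝ), 0 < r ∧ AnalyticOnNhd ℂ u₁ (Metric.ball 0 r) ∧
      AnalyticOnNhd ℂ u₂ (Metric.ball 0 r) ∧ g₁.1 = E.compGerm u₁ ℓ ∧ g₂.1 = E.compGerm u₂ ℓ := by
  obtain ⟨k₁, u₁, ℓ₁, ha₁, -, -, e₁⟩ := g₁.2
  obtain ⟨k₂, u₂, ℓ₂, ha₂, -, -, e₂⟩ := g₂.2
  let p₁ : (Fin (k₁ + k₂) → ℂ) →L[ℂ] (Fin k₁ → ℂ) :=
    ContinuousLinearMap.pi fun i => ContinuousLinearMap.proj (Fin.castAdd k₂ i)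
  let p₂ : (Fin (k₁ + k₂) → ℂ) →L[ℂ] (Fin k₂ → ℂ) :=
    ContinuousLinearMap.pi fun i => ContinuousLinearMap.proj (Fin.natAdd k₁ i)
  have b₁ : AnalyticAt ℂ (fun z => u₁ (p₁ z)) 0 :=
    AnalyticAt.fun_comp (by simpa using ha₁) (p₁.analyticAt 0)
  have b₂ : AnalyticAt ℂ (fun z => u₂ (p₂ z)) 0 :=
    AnalyticAt.fun_comp (by simpa using ha₂) (p₂.analyticAt 0)
  obtain ⟨r₁, hr₁, hb₁⟩ := b₁.exists_ball_analyticOnNhd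
  obtain ⟨r₂, hr₂, hb₂⟩ := b₂.exists_ball_analyticOnNhd
  refine ⟨k₁ + k₂, fun z => u₁ (p₁ z), fun z => u₂ (p₂ z), Fin.append ℓ₁ ℓ₂, min r₁ r₂,
    lt_min hr₁ hr₂, hb₁.mono (Metric.ball_subset_ball (min_le_left _ _)),
    hb₂.mono (Metric.ball_subset_ball (min_le_right _ _)), ?_, ?_⟩
  · rw [e₁, compGerm, compGerm]
    congr 1
    funext z
    congr 1
    funext i
    simp [p₁]
  · rw [e₂, compGerm, compGerm]
    congr 1
    funext z
    congr 1
    funext i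
    simp [p₂]

instance instNontrivialHol : Nontrivial E.Hol := by
  refine ⟨0, 1, fun h => ?_⟩
  have h1 : ((fun _ => 0 : CInf → ℂ) : Germ E.nhd ℂ) = ((fun _ => 1 : CInf → ℂ) : Germ E.nhd ℂ) :=
    congrArg Subtype.val h
  have h2 : ∀ᶠ _ in E.nhd, (0 : ℂ) = 1 := Germ.coe_eq.1 h1
  exact zero_ne_one (E.pure_le_nhd h2 : (0 : ℂ) = 1)

instance instNoZeroDivisorsHol : NoZeroDivisors E.Hol := by
  refine ⟨fun {g₁ g₂} h => ?_⟩
  obtain ⟨k, u₁, u₂, ℓ, r, hr, ha₁, ha₂, e₁, e₂⟩ := E.exists_common_rep g₁ g₂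
  have e : E.compGerm (fun w => u₁ w * u₂ w) ℓ = 0 := by
    have : g₁.1 * g₂.1 = 0 := congrArg Subtype.val h
    rwa [e₁, e₂] at this
  have hz := E.eq_zero_of_compGerm_eq_zero hr (ha₁.mul ha₂) e
  have hball : ∀ᶠ z in E.nhd, (fun i => E.cval (ℓ i) z) ∈ Metric.ball (0 : Fin k → ℂ) r :=
    (E.tendsto_cval_pi ℓ) (Metric.ball_mem_nhds _ hr)
  by_cases h1 : ∀ z, (fun i => E.cval (ℓ i) z) ∈ Metric.ball (0 : Fin k → ℂ) r →
      u₁ (fun i => E.cval (ℓ i) z) = 0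
  · left
    refine Subtype.ext (e₁.trans (Germ.coe_eq.2 ?_))
    filter_upwards [hball] with z hz using h1 z hz
  right
  push Not at h1
  obtain ⟨a, ha, hne⟩ := h1
  refine Subtype.ext (e₂.trans (Germ.coe_eq.2 ?_))
  filter_upwards [hball] with z hz'
  -- On the complex line through `a` and `z` one of the two factors vanishes identically.
  let γ : ℂ → (Fin k → ℂ) := fun t i => E.cval (ℓ i) (a + t • (z - a))
  let T : ℂ →L[ℂ] (Fin k → ℂ) :=
    (ContinuousLinearMap.id ℂ ℂ).smulRight fun i => E.cval (ℓ i) (z - a)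
  have hγ : γ = fun t => (fun i => E.cval (ℓ i) a) + T t := by
    funext t i
    simp [γ, T]
  have hγa : ∀ t, AnalyticAt ℂ γ t := fun t => by
    rw [hγ]
    exact analyticAt_const.add (T.analyticAt t)
  have hU : IsPreconnected (γ ⁻¹' Metric.ball 0 r) := by
    refine Convex.isPreconnected ?_
    have := ((convex_ball (0 : Fin k → ℂ) r).translate_preimage_right
      (fun i => E.cval (ℓ i) a)).linear_preimage (T.restrictScalars ℝ).toLinearMap
    rw [hγ]
    exact this
  have := AnalyticOnNhd.eq_zero_or_eq_zero_of_mul_eq_zero (U := γ ⁻¹' Metric.ball 0 r)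
    (f := fun t => u₁ (γ t)) (g := fun t => u₂ (γ t))
    (fun t ht => AnalyticAt.fun_comp (ha₁ _ ht) (hγa t))
    (fun t ht => AnalyticAt.fun_comp (ha₂ _ ht) (hγa t))
    (fun t ht => hz _ ht) hU
  rcases this with h0 | h0
  · exact absurd (by simpa [γ] using h0 0 (by simpa [γ] using ha)) hne
  · simpa [γ] using h0 1 (by simpa [γ] using hz')

instance instIsDomainHol : IsDomain E.Hol := NoZeroDivisors.to_isDomain _

/-! ### Linear forms as germs -/

/-- The inclusion of `ℒ` into the algebra of holomorphic germs. -/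
def formLin : E.Forms →ₗ[ℝ] E.Hol where
  toFun := E.formGerm
  map_add' ℓ m := Subtype.ext <| by
    change ((fun z => E.cval (ℓ + m) z : CInf → ℂ) : Germ E.nhd ℂ) = _
    simp only [cval_add]
    rfl
  map_smul' r ℓ := Subtype.ext <| by
    change ((fun z => E.cval (r • ℓ) z : CInf → ℂ) : Germ E.nhd ℂ) = _
    simp only [cval_smul, ← Complex.real_smul]
    rfl

theorem formLin_apply (ℓ : E.Forms) : E.formLin ℓ = E.formGerm ℓ := rfl

theorem formLin_injective : Function.Injective E.formLin := by
  refine (injective_iff_map_eq_zero _).2 fun ℓ h => ?_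
  refine E.eq_zero_of_cval fun z => ?_
  have h0 : E.compGerm (fun w : Fin 1 → ℂ => w 0) (fun _ => ℓ) = 0 := congrArg Subtype.val h
  have han : ∀ w : Fin 1 → ℂ, AnalyticAt ℂ (fun w : Fin 1 → ℂ => w 0) w := fun w =>
    (ContinuousLinearMap.proj (R := ℂ) (φ := fun _ : Fin 1 => ℂ) 0).analyticAt w
  exact E.eq_zero_of_compGerm_eq_zero (r := ‖fun _ : Fin 1 => E.cval ℓ z‖ + 1)
    (by positivity) (fun w _ => han w) h0 z (by simp)

theorem formGerm_ne_zero {ℓ : E.Forms} (h : ℓ ≠ 0) : E.formGerm ℓ ≠ 0 := fun h0 =>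
  h (E.formLin_injective (h0.trans (map_zero E.formLin).symm))

/-! ### Substitution of linear forms -/

/-- The complex linear map of `ℝ^∞ ⊗ ℂ` that corresponds to a linear map of `ℒ ≃ ℝ^∞`. -/
def complexMap (φ : E.Forms →ₗ[ℝ] E.Forms) : CInf →ₗ[ℂ] CInf :=
  Finsupp.linearCombination ℂ fun i =>
    complexify (E.dualVec (φ (E.dualVec.symm (Finsupp.single i 1))))

/-- A linear endomorphism of `ℒ` together with an adjoint. The adjoint is what makes it possible to
substitute forms in a germ, as it provides the map of points to compose with. -/
structure AdjointPair where
  toLin : E.Forms →ₗ[ℝ] E.Forms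
  adj : E.Forms →ₗ[ℝ] E.Forms
  inner_eq : ∀ x y, inner ℝ (toLin x) y = inner ℝ x (adj y)

namespace AdjointPair

variable {E}
variable (τ σ : E.AdjointPair)

theorem cval_complexMap (ℓ : E.Forms) (z : CInf) :
    E.cval ℓ (E.complexMap τ.adj z) = E.cval (τ.toLin ℓ) z := by
  have : E.cval ℓ ∘ₗ E.complexMap τ.adj = E.cval (τ.toLin ℓ) := by
    refine Finsupp.lhom_ext' fun i => LinearMap.ext_ring ?_
    simp only [LinearMap.comp_apply, Finsupp.lsingle_apply, cval_single, complexMap,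
      Finsupp.linearCombination_single, one_smul, cval_complexify, one_mul, toDual_eq_formQ,
      LinearEquiv.symm_apply_apply, ← inner_eq_formQ, τ.inner_eq]
  exact LinearMap.congr_fun this z

theorem tendsto_complexMap : Tendsto (E.complexMap τ.adj) E.nhd E.nhd :=
  E.tendsto_nhd fun ℓ => by simpa only [cval_complexMap] using E.tendsto_cval _

theorem compTendsto_compGerm {k : ℕ} (h : (Fin k → ℂ) → ℂ) (ℓ : Fin k → E.Forms) :
    (E.compGerm h ℓ).compTendsto _ τ.tendsto_complexMap =
      E.compGerm h fun i => τ.toLin (ℓ i) := by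
  simp only [compGerm, Germ.coe_compTendsto, Function.comp_def, cval_complexMap]

theorem isHolIn_compTendsto {P P' : E.Forms → Prop} (hP : ∀ ℓ, P ℓ → P' (τ.toLin ℓ))
    {g : Germ E.nhd ℂ} (hg : E.IsHolIn P g) :
    E.IsHolIn P' (g.compTendsto _ τ.tendsto_complexMap) := by
  obtain ⟨k, h, ℓ, ha, hr, hℓ, rfl⟩ := hg
  exact ⟨k, h, fun i => τ.toLin (ℓ i), ha, hr, fun i => hP _ (hℓ i), τ.compTendsto_compGerm h ℓ⟩

/-- The substitution `h(ℓ₁, …, ℓₖ) ↦ h(τ ℓ₁, …, τ ℓₖ)` on holomorphic germs. -/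
def pull : E.Hol →ₐ[ℝ] E.Hol where
  toFun g := ⟨g.1.compTendsto _ τ.tendsto_complexMap,
    τ.isHolIn_compTendsto (P := fun _ => True) (P' := fun _ => True) (fun _ _ => trivial)
      (g := g.1) g.2⟩
  map_one' := Subtype.ext rfl
  map_zero' := Subtype.ext rfl
  map_mul' := by
    rintro ⟨f, hf⟩ ⟨g, hg⟩
    refine Subtype.ext ?_
    induction f using Germ.inductionOn
    induction g using Germ.inductionOn
    rfl
  map_add' := by
    rintro ⟨f, hf⟩ ⟨g, hg⟩
    refine Subtype.ext ?_
    induction f using Germ.inductionOn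
    induction g using Germ.inductionOn
    rfl
  commutes' _ := Subtype.ext rfl

theorem pull_val (g : E.Hol) : (τ.pull g).1 = g.1.compTendsto _ τ.tendsto_complexMap := rfl

theorem pull_formGerm (ℓ : E.Forms) : τ.pull (E.formGerm ℓ) = E.formGerm (τ.toLin ℓ) :=
  Subtype.ext <| τ.compTendsto_compGerm (fun w : Fin 1 → ℂ => w 0) fun _ => ℓ

theorem pull_sinGerm (ℓ : E.Forms) : τ.pull (E.sinGerm ℓ) = E.sinGerm (τ.toLin ℓ) :=
  Subtype.ext <|
    τ.compTendsto_compGerm (fun w : Fin 1 → ℂ => Complex.sin (Real.pi * w 0)) fun _ => ℓ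

theorem pull_isHolIn {P P' : E.Forms → Prop} (hP : ∀ ℓ, P ℓ → P' (τ.toLin ℓ)) {g : E.Hol}
    (hg : E.IsHolIn P g.1) : E.IsHolIn P' (τ.pull g).1 :=
  τ.isHolIn_compTendsto hP hg

theorem pull_eq_self {P : E.Forms → Prop} (hP : ∀ ℓ, P ℓ → τ.toLin ℓ = ℓ) {g : E.Hol}
    (hg : E.IsHolIn P g.1) : τ.pull g = g := by
  obtain ⟨k, h, ℓ, ha, hr, hℓ, e⟩ := hg
  refine Subtype.ext ?_
  rw [pull_val, e, compTendsto_compGerm]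
  simp only [hP _ (hℓ _)]

theorem pull_pull_of_leftInverse (h : ∀ ℓ, σ.toLin (τ.toLin ℓ) = ℓ) (g : E.Hol) :
    σ.pull (τ.pull g) = g := by
  obtain ⟨k, u, ℓ, ha, hr, hℓ, e⟩ := g.2
  refine Subtype.ext ?_
  rw [pull_val, pull_val, e, compTendsto_compGerm, compTendsto_compGerm]
  simp only [h]

theorem evZero_pull (g : E.Hol) : E.evZero (τ.pull g) = E.evZero g := by
  obtain ⟨f, hf⟩ := g
  induction f using Germ.inductionOn with | _ f
  change f (E.complexMap τ.adj 0) = f 0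
  rw [map_zero]

end AdjointPair

/-- The map that is multiplication by `c` on `W` and the identity on the orthogonal complement. -/
def dilation (c : ℝ) (W : Submodule ℝ E.Forms) [FiniteDimensional ℝ W] : E.AdjointPair where
  toLin := LinearMap.id + (c - 1) • W.starProjection.toLinearMap
  adj := LinearMap.id + (c - 1) • W.starProjection.toLinearMap
  inner_eq x y := by
    simp only [LinearMap.add_apply, LinearMap.id_apply, LinearMap.smul_apply, inner_add_left,
      inner_add_right, inner_smul_left, inner_smul_right, ContinuousLinearMap.coe_coe,
      Submodule.inner_starProjection_left_eq_right]
    simp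

variable {E}

theorem dilation_apply (c : ℝ) (W : Submodule ℝ E.Forms) [FiniteDimensional ℝ W] (x : E.Forms) :
    (E.dilation c W).toLin x = x + (c - 1) • W.starProjection x := rfl

theorem dilation_of_mem (c : ℝ) {W : Submodule ℝ E.Forms} [FiniteDimensional ℝ W] {x : E.Forms}
    (hx : x ∈ W) : (E.dilation c W).toLin x = c • x := by
  rw [dilation_apply, Submodule.starProjection_eq_self_iff.2 hx]
  module

theorem dilation_of_mem_orthogonal (c : ℝ) {W : Submodule ℝ E.Forms} [FiniteDimensional ℝ W]
    {x : E.Forms} (hx : x ∈ Wᗮ) : (E.dilation c W).toLin x = x := by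
  rw [dilation_apply, (Submodule.starProjection_apply_eq_zero_iff W).2 hx]
  simp

theorem dilation_zero_mem_orthogonal (W : Submodule ℝ E.Forms) [FiniteDimensional ℝ W]
    (x : E.Forms) : (E.dilation 0 W).toLin x ∈ Wᗮ := by
  rw [dilation_apply, zero_sub, neg_one_smul, ← sub_eq_add_neg]
  exact Submodule.sub_starProjection_mem_orthogonal x

/-- The projection of `ℒ` onto the orthogonal complement of `L`. -/
abbrev projPerp (L : E.Forms) : E.AdjointPair := E.dilation 0 (ℝ ∙ L)

theorem projPerp_self (L : E.Forms) : (projPerp L).toLin L = 0 := by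
  rw [dilation_of_mem 0 (Submodule.mem_span_singleton_self L), zero_smul]

theorem exists_eq_smul_add_projPerp (L x : E.Forms) :
    ∃ c : ℝ, x = c • L + (projPerp L).toLin x := by
  obtain ⟨c, hc⟩ := Submodule.mem_span_singleton.1 ((ℝ ∙ L).starProjection_apply_mem x)
  exact ⟨c, by rw [dilation_apply, hc]; module⟩

/-! ### Hadamard's lemma for germs -/

/-- The quotient of a germ with real coefficients by the first variable has real coefficients. -/
theorem hasRealCoeffs_quot {k : ℕ} {f G : (Fin (k + 1) → ℂ) → ℂ} (hG : AnalyticAt ℂ G 0)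
    (hf : HasRealCoeffs f) (hfG : ∀ᶠ v in 𝓝 0, f v = v 0 * G v) : HasRealCoeffs G := by
  have tstar : Tendsto (star : (Fin (k + 1) → ℂ) → _) (𝓝 0) (𝓝 0) := by
    simpa using (continuous_star (R := Fin (k + 1) → ℂ)).tendsto 0
  have hcont := hG.eventually_continuousAt
  have hall : ∀ᶠ v in 𝓝 (0 : Fin (k + 1) → ℂ), v 0 ≠ 0 → G (star v) = star (G v) := by
    filter_upwards [hf, hfG, tstar.eventually hfG] with v h1 h2 h3 hv
    rw [h3, h2, star_mul'] at h1
    exact mul_left_cancel₀ (star_ne_zero.2 hv) h1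
  filter_upwards [hall.eventually_nhds, hcont, tstar.eventually hcont] with v h1 h2 h3
  -- At points with `v 0 = 0` the identity follows by continuity.
  let γ : ℂ → (Fin (k + 1) → ℂ) := fun s => v + Function.update (0 : Fin (k + 1) → ℂ) 0 s
  have hγ : Continuous γ := by fun_prop
  have tγ : Tendsto γ (𝓝[≠] (0 : ℂ)) (𝓝 v) := by
    have : Tendsto γ (𝓝 0) (𝓝 v) := by simpa [γ] using hγ.tendsto 0
    exact this.mono_left nhdsWithin_le_nhds
  have hne : ∀ᶠ s in 𝓝[≠] (0 : ℂ), γ s 0 ≠ 0 := by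
    by_cases hv : v 0 = 0
    · filter_upwards [self_mem_nhdsWithin] with s hs
      simpa [γ, hv] using hs
    · exact (tγ.eventually (((continuous_apply 0).continuousAt.eventually_ne hv)))
  have e : ∀ᶠ s in 𝓝[≠] (0 : ℂ), G (star (γ s)) = star (G (γ s)) := by
    filter_upwards [tγ.eventually h1, hne] with s h4 h5 using h4 h5
  have l1 : Tendsto (fun s => G (star (γ s))) (𝓝[≠] (0 : ℂ)) (𝓝 (G (star v))) :=
    h3.tendsto.comp ((continuous_star.tendsto v).comp tγ)
  have l2 : Tendsto (fun s => star (G (γ s))) (𝓝[≠] (0 : ℂ)) (𝓝 (star (G v))) :=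
    (continuous_star.tendsto _).comp (h2.tendsto.comp tγ)
  exact tendsto_nhds_unique (l1.congr' e) l2

/-- Hadamard's lemma: the difference of a germ and its restriction to the hyperplane `L = 0` is
divisible by `L`. -/
theorem exists_sub_pull_projPerp_eq (L : E.Forms) (g : E.Hol) :
    ∃ g' : E.Hol, g - (projPerp L).pull g = E.formGerm L * g' := by
  obtain ⟨k, h, ℓ, ha, hr, -, e⟩ := g.2
  choose c hc using fun i => exists_eq_smul_add_projPerp L (ℓ i)
  let B : (Fin (k + 1) → ℂ) →L[ℂ] (Fin k → ℂ) :=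
    ContinuousLinearMap.pi fun i => ContinuousLinearMap.proj i.succ
  let A : (Fin (k + 1) → ℂ) →L[ℂ] (Fin k → ℂ) :=
    B + (ContinuousLinearMap.proj (R := ℂ) (φ := fun _ : Fin (k + 1) => ℂ) 0).smulRight
      fun i => (c i : ℂ)
  have hAB : ∀ v, A v - B v = v 0 • fun i => (c i : ℂ) := fun v => by simp [A]
  obtain ⟨G, hG, hev⟩ := exists_analyticAt_quot ha A B _ (fun v => v 0) hAB
  have tA : Tendsto A (𝓝 0) (𝓝 0) := by simpa using A.continuous.tendsto 0
  have tB : Tendsto B (𝓝 0) (𝓝 0) := by simpa using B.continuous.tendsto 0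
  have hreal : HasRealCoeffs fun v => h (A v) - h (B v) := by
    filter_upwards [tA.eventually hr, tB.eventually hr] with v h1 h2
    have s1 : A (star v) = star (A v) := by
      funext i
      simp [A, B]
    have s2 : B (star v) = star (B v) := rfl
    rw [s1, s2, h1, h2, star_sub]
  let m : Fin (k + 1) → E.Forms := Fin.cons L fun i => (projPerp L).toLin (ℓ i)
  refine ⟨⟨E.compGerm G m, k + 1, G, m, hG, hasRealCoeffs_quot hG hreal hev, fun _ => trivial,
    rfl⟩, Subtype.ext ?_⟩
  change g.1 - ((projPerp L).pull g).1 = (E.formGerm L).1 * E.compGerm G m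
  rw [AdjointPair.pull_val, e, AdjointPair.compTendsto_compGerm]
  refine Germ.coe_eq.2 ?_
  filter_upwards [(E.tendsto_cval_pi m).eventually hev] with z hz
  have hA : A (fun i => E.cval (m i) z) = fun i => E.cval (ℓ i) z := by
    funext i
    conv_rhs => rw [hc i, cval_add, cval_smul]
    simp [A, B, m]
    ring
  have hB : B (fun i => E.cval (m i) z) = fun i => E.cval ((projPerp L).toLin (ℓ i)) z := by
    funext i
    simp [B, m]
  rw [hA, hB] at hz
  simpa [m] using hz

theorem eq_formGerm_mul_of_pull_eq_zero {L : E.Forms} {g : E.Hol}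
    (h : (projPerp L).pull g = 0) : ∃ g' : E.Hol, g = E.formGerm L * g' := by
  obtain ⟨g', hg'⟩ := exists_sub_pull_projPerp_eq L g
  exact ⟨g', by rw [← hg', h, sub_zero]⟩

/-! ### The hyperplane section of a space of forms -/

/-- The forms in `W` orthogonal to `L`. -/
abbrev perpIn (W : Submodule ℝ E.Forms) (L : E.Forms) : Submodule ℝ E.Forms := W ⊓ (ℝ ∙ L)ᗮ

theorem projPerp_mem_perpIn {W : Submodule ℝ E.Forms} {L x : E.Forms} (hL : L ∈ W) (hx : x ∈ W) :
    (projPerp L).toLin x ∈ perpIn W L := by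
  refine ⟨?_, dilation_zero_mem_orthogonal _ x⟩
  obtain ⟨c, hc⟩ := exists_eq_smul_add_projPerp L x
  rw [← sub_eq_iff_eq_add'] at hc
  rw [← hc]
  exact W.sub_mem hx (W.smul_mem _ hL)

theorem projPerp_of_mem_perpIn {W : Submodule ℝ E.Forms} {L x : E.Forms} (hx : x ∈ perpIn W L) :
    (projPerp L).toLin x = x := dilation_of_mem_orthogonal 0 hx.2

theorem perpIn_sup {W : Submodule ℝ E.Forms} {L : E.Forms} (hL : L ∈ W) :
    perpIn W L ⊔ ℝ ∙ L = W := by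
  refine le_antisymm (sup_le inf_le_left (by simpa using hL)) fun x hx => ?_
  obtain ⟨c, hc⟩ := exists_eq_smul_add_projPerp L x
  rw [hc]
  exact add_mem (Submodule.mem_sup_right (Submodule.mem_span_singleton.2 ⟨c, rfl⟩))
    (Submodule.mem_sup_left (projPerp_mem_perpIn hL hx))

theorem finrank_perpIn_lt {W : Submodule ℝ E.Forms} [FiniteDimensional ℝ W] {L : E.Forms}
    (hL : L ∈ W) (h0 : L ≠ 0) : Module.finrank ℝ (perpIn W L) < Module.finrank ℝ W := by
  refine Submodule.finrank_lt_finrank_of_lt (lt_of_le_of_ne inf_le_left fun h => h0 ?_)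
  have h1 : L ∈ perpIn W L := by rw [h]; exact hL
  rw [← projPerp_of_mem_perpIn h1, projPerp_self]

/-! ### Existence of the decomposition -/

/-- Restriction to the orthogonal complement of `W` changes a germ by an element of the ideal
generated by `W`. -/
theorem exists_isHolIn_orthogonal (W : Submodule ℝ E.Forms) [FiniteDimensional ℝ W] (g : E.Hol) :
    ∃ g₀ : E.Hol, E.IsHolIn (fun ℓ => ℓ ∈ Wᗮ) g₀.1 ∧
      g - g₀ ∈ Ideal.span (E.formGerm '' (W : Set E.Forms)) := by
  induction hn : Module.finrank ℝ W using Nat.strong_induction_on generalizing W with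
  | _ n ih
  by_cases hW : W = ⊥
  · obtain ⟨k, h, ℓ, ha, hr, -, e⟩ := g.2
    exact ⟨g, ⟨k, h, ℓ, ha, hr, fun i => by simp [hW], e⟩, by simp⟩
  obtain ⟨L, hL, h0⟩ := Submodule.exists_mem_ne_zero_of_ne_bot hW
  have hlt := finrank_perpIn_lt hL h0
  rw [hn] at hlt
  obtain ⟨g₁, hg₁, hd₁⟩ := ih _ hlt (perpIn W L) rfl
  obtain ⟨g', hg'⟩ := exists_sub_pull_projPerp_eq L g₁
  refine ⟨(projPerp L).pull g₁, AdjointPair.pull_isHolIn _ (fun ℓ hℓ => ?_) hg₁, ?_⟩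
  · rw [← perpIn_sup hL, ← Submodule.inf_orthogonal]
    refine ⟨?_, dilation_zero_mem_orthogonal _ ℓ⟩
    obtain ⟨c, hc⟩ := exists_eq_smul_add_projPerp L ℓ
    rw [← sub_eq_iff_eq_add'] at hc
    rw [← hc]
    refine Submodule.sub_mem _ hℓ (Submodule.smul_mem _ _ ?_)
    rw [Submodule.mem_orthogonal']
    intro u hu
    exact (Submodule.mem_orthogonal _ _).1 hu.2 L (Submodule.mem_span_singleton_self L)
  · have := Ideal.add_mem _ (Ideal.span_mono (Set.image_mono (inf_le_left : perpIn W L ≤ W)) hd₁)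
      (Ideal.mul_mem_right g' _ (Ideal.subset_span (Set.mem_image_of_mem E.formGerm hL)))
    rwa [← hg', sub_add_sub_cancel] at this

/-- Existence of the decomposition, by induction on the number `n` of factors of the denominator. -/
theorem mk_prod_mem_sup (n : ℕ) (L : Fin n → E.Forms) (hL : ∀ j, L j ≠ 0) (g : E.Hol) :
    Localization.mk g ⟨∏ j, E.formGerm (L j), E.prod_mem_poles hL⟩ ∈
      LinearMap.range (IsScalarTower.toAlgHom ℝ E.Hol E.Mer).toLinearMap ⊔ E.Polar := by
  induction n generalizing g with
  | zero =>
    refine Submodule.mem_sup_left ⟨g, ?_⟩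
    simp only [Finset.univ_eq_empty, Finset.prod_empty]
    exact (Localization.mk_one_eq_algebraMap g).symm
  | succ n ih =>
    let W := Submodule.span ℝ (Set.range L)
    have : FiniteDimensional ℝ W := FiniteDimensional.span_of_finite ℝ (Set.finite_range L)
    obtain ⟨g₀, hg₀, hd⟩ := exists_isHolIn_orthogonal W g
    have hW : Ideal.span (E.formGerm '' (W : Set E.Forms)) ≤
        Ideal.span (Set.range fun j => E.formGerm (L j)) := by
      refine Ideal.span_le.2 ?_
      rintro _ ⟨x, hx, rfl⟩
      have : W ≤ ((Ideal.span (Set.range fun j => E.formGerm (L j))).restrictScalars ℝ).comap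
          E.formLin := by
        refine Submodule.span_le.2 ?_
        rintro _ ⟨j, rfl⟩
        exact Ideal.subset_span ⟨j, rfl⟩
      exact this hx
    obtain ⟨c, hc⟩ := Ideal.mem_span_range_iff_exists_fun.1 (hW hd)
    have hpol : Localization.mk g₀ ⟨∏ j, E.formGerm (L j), E.prod_mem_poles hL⟩ ∈ E.Polar := by
      refine Submodule.subset_span ⟨n + 1, L, hL, g₀, Nat.succ_pos n, ?_, rfl⟩
      obtain ⟨k, h, ℓ, ha, hr, hP, e⟩ := hg₀
      refine ⟨k, h, ℓ, ha, hr, fun i j => ?_, e⟩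
      exact (Submodule.mem_orthogonal' _ _).1 (hP i) (L j) (Submodule.subset_span ⟨j, rfl⟩)
    have hsplit : Localization.mk g ⟨∏ j, E.formGerm (L j), E.prod_mem_poles hL⟩ =
        Localization.mk g₀ ⟨∏ j, E.formGerm (L j), E.prod_mem_poles hL⟩ +
        ∑ j, Localization.mk (c j) ⟨∏ i, E.formGerm (L (j.succAbove i)),
          E.prod_mem_poles fun i => hL (j.succAbove i)⟩ := by
      have h1 : g = g₀ + ∑ j, c j * E.formGerm (L j) := by rw [hc]; ring
      conv_lhs => rw [h1, ← Localization.add_mk_self, Localization.mk_sum]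
      congr 1
      refine Finset.sum_congr rfl fun j _ => ?_
      rw [Localization.mk_eq_mk_iff, Localization.r_iff_exists]
      refine ⟨1, ?_⟩
      simp only [Fin.prod_univ_succAbove _ j]
      ring
    rw [hsplit]
    exact add_mem (Submodule.mem_sup_right hpol) (sum_mem fun j _ => ih _ (fun i => hL _) _)

/-- Every germ in `ℳ` has a holomorphic component. -/
theorem exists_isHolPart (f : E.Mer) : ∃ g, E.IsHolPart f g := by
  have hf : f ∈ LinearMap.range (IsScalarTower.toAlgHom ℝ E.Hol E.Mer).toLinearMap ⊔ E.Polar := by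
    induction f using Localization.induction_on with | _ x
    obtain ⟨g, s, hs⟩ := x
    obtain ⟨l, hl, rfl⟩ := Submonoid.exists_list_of_mem_closure hs
    choose! L hL using hl
    have := mk_prod_mem_sup l.length (fun i => L (l.get i)) (fun i => (hL _ (l.get_mem i)).1) g
    convert this using 3
    rw [← List.prod_ofFn]
    conv_lhs => rw [← List.ofFn_get l]
    congr 2
    funext i
    exact (hL _ (l.get_mem i)).2
  obtain ⟨_, ⟨g, rfl⟩, p, hp, rfl⟩ := Submodule.mem_sup.1 hf
  refine ⟨g, ?_⟩
  have h : (IsScalarTower.toAlgHom ℝ E.Hol E.Mer).toLinearMap g = algebraMap E.Hol E.Mer g := rfl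
  have h2 : algebraMap E.Hol E.Mer g + p - algebraMap E.Hol E.Mer g = p := by ring
  rw [IsHolPart, h, h2]
  exact hp

/-! ### Fractions of holomorphic germs -/

variable (E) in
/-- The field of fractions of the algebra of holomorphic germs. -/
abbrev Frac : Type := FractionRing E.Hol

instance instFieldFrac : Field E.Frac := FractionRing.field E.Hol

variable (E) in
/-- The product of a multiset of linear forms, as a germ. -/
def formProd (s : Multiset E.Forms) : E.Hol := (s.map E.formGerm).prod

theorem formProd_zero : E.formProd 0 = 1 := by simp [formProd]

theorem formProd_cons (L : E.Forms) (s : Multiset E.Forms) :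
    E.formProd (L ::ₘ s) = E.formGerm L * E.formProd s := by simp [formProd]

theorem formProd_add (s t : Multiset E.Forms) :
    E.formProd (s + t) = E.formProd s * E.formProd t := by simp [formProd]

theorem formProd_ne_zero {s : Multiset E.Forms} (hs : ∀ L ∈ s, L ≠ 0) : E.formProd s ≠ 0 := by
  refine Multiset.prod_ne_zero fun h => ?_
  obtain ⟨L, hL, h0⟩ := Multiset.mem_map.1 h
  exact formGerm_ne_zero E (hs L hL) h0

theorem pull_formProd (τ : E.AdjointPair) (s : Multiset E.Forms) :
    τ.pull (E.formProd s) = E.formProd (s.map τ.toLin) := by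
  simp only [formProd, map_multiset_prod, Multiset.map_map, Function.comp_def, τ.pull_formGerm]

theorem algebraMap_frac_ne_zero {a : E.Hol} (h : a ≠ 0) : algebraMap E.Hol E.Frac a ≠ 0 := by
  rwa [Ne, map_eq_zero_iff _ (IsFractionRing.injective E.Hol E.Frac)]

/-- The fractions without a pole along the hyperplane `L = 0`. -/
def regularAlong (L : E.Forms) : Subalgebra ℝ E.Frac where
  carrier := {x | ∃ a b : E.Hol, (projPerp L).pull b ≠ 0 ∧
    x = algebraMap E.Hol E.Frac a / algebraMap E.Hol E.Frac b}
  add_mem' := by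
    rintro _ _ ⟨a, b, hb, rfl⟩ ⟨c, d, hd, rfl⟩
    refine ⟨a * d + b * c, b * d, by rw [map_mul]; exact mul_ne_zero hb hd, ?_⟩
    rw [div_add_div _ _ (algebraMap_frac_ne_zero fun h => hb (by simp [h]))
      (algebraMap_frac_ne_zero fun h => hd (by simp [h]))]
    simp only [map_add, map_mul]
  mul_mem' := by
    rintro _ _ ⟨a, b, hb, rfl⟩ ⟨c, d, hd, rfl⟩
    refine ⟨a * c, b * d, by rw [map_mul]; exact mul_ne_zero hb hd, ?_⟩
    rw [div_mul_div_comm]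
    simp only [map_mul]
  algebraMap_mem' r := ⟨algebraMap ℝ E.Hol r, 1, by simp, by
    rw [map_one, div_one, ← IsScalarTower.algebraMap_apply]⟩

theorem algebraMap_mem_regularAlong (L : E.Forms) (a : E.Hol) :
    algebraMap E.Hol E.Frac a ∈ regularAlong L := ⟨a, 1, by simp, by simp⟩

theorem inv_formProd_mem_regularAlong {L : E.Forms} {s : Multiset E.Forms}
    (hs : ∀ M ∈ s, (projPerp L).toLin M ≠ 0) :
    (algebraMap E.Hol E.Frac (E.formProd s))⁻¹ ∈ regularAlong L := by
  refine ⟨1, E.formProd s, ?_, by simp⟩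
  rw [pull_formProd]
  refine formProd_ne_zero fun M hM => ?_
  obtain ⟨M', hM', rfl⟩ := Multiset.mem_map.1 hM
  exact hs M' hM'

/-- A fraction of germs with poles along hyperplanes, none of which is really a pole, is a
holomorphic germ. -/
theorem exists_eq_algebraMap_of_regularAlong (s : Multiset E.Forms) (hs : ∀ L ∈ s, L ≠ 0)
    (a : E.Hol) (h : ∀ L : E.Forms, L ≠ 0 →
      algebraMap E.Hol E.Frac a / algebraMap E.Hol E.Frac (E.formProd s) ∈ regularAlong L) :
    ∃ g : E.Hol, algebraMap E.Hol E.Frac a / algebraMap E.Hol E.Frac (E.formProd s) =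
      algebraMap E.Hol E.Frac g := by
  induction s using Multiset.induction_on generalizing a with
  | empty => exact ⟨a, by simp [formProd_zero]⟩
  | cons L s ih =>
    have hL : L ≠ 0 := hs L (Multiset.mem_cons_self L s)
    have hs' : ∀ M ∈ s, M ≠ 0 := fun M hM => hs M (Multiset.mem_cons_of_mem hM)
    have hL1 := algebraMap_frac_ne_zero (formGerm_ne_zero E hL)
    have hs1 := algebraMap_frac_ne_zero (formProd_ne_zero hs')
    obtain ⟨p, q, hq, e⟩ := h L hL
    have hq1 : algebraMap E.Hol E.Frac q ≠ 0 := algebraMap_frac_ne_zero fun h => hq (by simp [h])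
    have e2 : a * q = p * (E.formGerm L * E.formProd s) := by
      refine IsFractionRing.injective E.Hol E.Frac ?_
      rw [formProd_cons, map_mul, div_eq_div_iff (mul_ne_zero hL1 hs1) hq1] at e
      simpa only [map_mul] using e
    have e3 := congrArg (projPerp L).pull e2
    have e0 : E.formGerm (0 : E.Forms) = 0 := map_zero E.formLin
    rw [map_mul, map_mul, map_mul, AdjointPair.pull_formGerm, projPerp_self, e0, zero_mul, mul_zero]
      at e3
    obtain ⟨a', rfl⟩ := eq_formGerm_mul_of_pull_eq_zero ((mul_eq_zero.1 e3).resolve_right hq)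
    have e4 : algebraMap E.Hol E.Frac (E.formGerm L * a') /
        algebraMap E.Hol E.Frac (E.formProd (L ::ₘ s)) =
        algebraMap E.Hol E.Frac a' / algebraMap E.Hol E.Frac (E.formProd s) := by
      rw [formProd_cons, map_mul, map_mul, mul_div_mul_left _ _ hL1]
    rw [e4]
    exact ih hs' a' fun M hM => e4 ▸ h M hM

/-- The fractions `a / b` with `a` and `b` invariant under the restriction to `L = 0`. -/
def fixedFrac (L : E.Forms) : Submodule ℝ E.Frac where
  carrier := {x | ∃ a b : E.Hol, b ≠ 0 ∧ (projPerp L).pull a = a ∧ (projPerp L).pull b = b ∧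
    x = algebraMap E.Hol E.Frac a / algebraMap E.Hol E.Frac b}
  add_mem' := by
    rintro _ _ ⟨a, b, hb, ea, eb, rfl⟩ ⟨c, d, hd, ec, ed, rfl⟩
    refine ⟨a * d + b * c, b * d, mul_ne_zero hb hd, by simp only [map_add, map_mul, ea, eb, ec, ed],
      by simp only [map_mul, eb, ed], ?_⟩
    rw [div_add_div _ _ (algebraMap_frac_ne_zero hb) (algebraMap_frac_ne_zero hd)]
    simp only [map_add, map_mul]
  zero_mem' := ⟨0, 1, one_ne_zero, by simp, by simp, by simp⟩
  smul_mem' := by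
    rintro r _ ⟨a, b, hb, ea, eb, rfl⟩
    refine ⟨r • a, b, hb, by rw [map_smul, ea], eb, ?_⟩
    rw [Algebra.smul_def, Algebra.smul_def, map_mul, ← IsScalarTower.algebraMap_apply, mul_div_assoc]

theorem fixedFrac_le_regularAlong (L : E.Forms) :
    fixedFrac L ≤ Subalgebra.toSubmodule (regularAlong L) := by
  rintro _ ⟨a, b, hb, ea, eb, rfl⟩
  exact ⟨a, b, by rwa [eb], rfl⟩

/-- A fraction independent of `L` that is divisible by `L` vanishes. -/
theorem eq_zero_of_mem_fixedFrac {L : E.Forms} {x y : E.Frac} (hx : x ∈ fixedFrac L)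
    (hy : y ∈ regularAlong L) (h : x = algebraMap E.Hol E.Frac (E.formGerm L) * y) : x = 0 := by
  obtain ⟨a, b, hb, ea, eb, rfl⟩ := hx
  obtain ⟨p, q, hq, rfl⟩ := hy
  have hb1 := algebraMap_frac_ne_zero hb
  have hq1 : algebraMap E.Hol E.Frac q ≠ 0 := algebraMap_frac_ne_zero fun h => hq (by simp [h])
  have e : a * q = E.formGerm L * p * b := by
    refine IsFractionRing.injective E.Hol E.Frac ?_
    rw [← mul_div_assoc, div_eq_div_iff hb1 hq1] at h
    simpa only [map_mul] using h
  have e3 := congrArg (projPerp L).pull e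
  have e0 : E.formGerm (0 : E.Forms) = 0 := map_zero E.formLin
  rw [map_mul, map_mul, map_mul, AdjointPair.pull_formGerm, projPerp_self, e0, zero_mul, zero_mul,
    ea] at e3
  rw [(mul_eq_zero.1 e3).resolve_right hq]
  simp

/-- The polynomial `∑ rᵢ L^{-(i+1)}` in `1 / L` without constant term. -/
def principalPart (L : E.Forms) : (ℕ →₀ E.Frac) →ₗ[E.Frac] E.Frac :=
  Finsupp.linearCombination E.Frac fun i => (algebraMap E.Hol E.Frac (E.formGerm L))⁻¹ ^ (i + 1)

/-- Principal parts along `L = 0` are unique. -/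
theorem eq_zero_of_principalPart_mem {L : E.Forms} (hL : L ≠ 0) {r : ℕ →₀ E.Frac}
    (hr : ∀ i, r i ∈ fixedFrac L) (h : principalPart L r ∈ regularAlong L) : r = 0 := by
  have hL1 := algebraMap_frac_ne_zero (formGerm_ne_zero E hL)
  set l := algebraMap E.Hol E.Frac (E.formGerm L) with hl
  have hlmem : l ∈ regularAlong L := algebraMap_mem_regularAlong L _
  have key : ∀ N : ℕ, (∀ i, N ≤ i → r i = 0) → r = 0 := by
    intro N
    induction N with
    | zero => exact fun h => Finsupp.ext fun i => h i (Nat.zero_le i)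
    | succ N ih =>
      intro hN
      have hsum : principalPart L r = ∑ i ∈ Finset.range (N + 1), r i * l⁻¹ ^ (i + 1) := by
        rw [principalPart, Finsupp.linearCombination_apply]
        refine Finsupp.sum_of_support_subset _ (fun i hi => ?_) _ (by simp)
        rw [Finset.mem_range]
        by_contra hlt
        exact Finsupp.mem_support_iff.1 hi (hN i (by omega))
      -- Multiplication by `L ^ (N + 1)` isolates the leading coefficient modulo `L`.
      have hlead : r N = l * (l ^ N * principalPart L r -
          ∑ i ∈ Finset.range N, r i * l ^ (N - 1 - i)) := by
        rw [hsum, Finset.sum_range_succ, mul_sub, ← mul_assoc, ← pow_succ', mul_add,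
          Finset.mul_sum, Finset.mul_sum]
        have h1 : l ^ (N + 1) * (r N * l⁻¹ ^ (N + 1)) = r N := by
          rw [inv_pow]
          field_simp
        have h2 : ∀ i ∈ Finset.range N, l ^ (N + 1) * (r i * l⁻¹ ^ (i + 1)) =
            l * (r i * l ^ (N - 1 - i)) := by
          intro i hi
          obtain ⟨k, rfl⟩ := Nat.exists_eq_add_of_lt (Finset.mem_range.1 hi)
          rw [show i + k + 1 - 1 - i = k by omega, inv_pow]
          field_simp
          ring
        rw [h1, Finset.sum_congr rfl h2]
        ring
      refine ih fun i hi => ?_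
      rcases hi.eq_or_lt with rfl | hlt
      · refine eq_zero_of_mem_fixedFrac (hr _) ?_ hlead
        refine sub_mem (mul_mem (pow_mem hlmem _) h) (sum_mem fun i _ => mul_mem ?_ (pow_mem hlmem _))
        exact fixedFrac_le_regularAlong L (hr i)
      · exact hN i hlt
  refine key (r.support.sup id + 1) fun i hi => ?_
  by_contra h0
  have := Finset.le_sup (f := id) (Finsupp.mem_support_iff.2 h0)
  simp only [id] at this
  omega

/-! ### Polar germs by the span of their denominators -/

/-- The space spanned by the polar germs `g / (L₁ ⋯ Lₙ)` whose denominators span `W`, with `g`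
depending on forms orthogonal to `W`. -/
def polarAlong (W : Submodule ℝ E.Forms) : Submodule ℝ E.Frac :=
  Submodule.span ℝ {x | ∃ (g : E.Hol) (s : Multiset E.Forms), E.IsHolIn (fun ℓ => ℓ ∈ Wᗮ) g.1 ∧
    (∀ L ∈ s, L ≠ 0) ∧ Submodule.span ℝ {L | L ∈ s} = W ∧
    x = algebraMap E.Hol E.Frac g / algebraMap E.Hol E.Frac (E.formProd s)}

theorem IsHolIn.mono {P P' : E.Forms → Prop} (h : ∀ ℓ, P ℓ → P' ℓ) {g : Germ E.nhd ℂ}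
    (hg : E.IsHolIn P g) : E.IsHolIn P' g := by
  obtain ⟨k, u, ℓ, ha, hr, hℓ, e⟩ := hg
  exact ⟨k, u, ℓ, ha, hr, fun i => h _ (hℓ i), e⟩

theorem exists_eq_smul_of_projPerp_eq_zero {L M : E.Forms} (h : (projPerp L).toLin M = 0) :
    ∃ c : ℝ, M = c • L := by
  obtain ⟨c, hc⟩ := exists_eq_smul_add_projPerp L M
  exact ⟨c, by rw [h, add_zero] at hc; exact hc⟩

theorem polarAlong_le_regularAlong {W : Submodule ℝ E.Forms} {L : E.Forms} (hL : L ∉ W) :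
    polarAlong W ≤ Subalgebra.toSubmodule (regularAlong L) := by
  refine Submodule.span_le.2 ?_
  rintro _ ⟨g, s, -, hs, rfl, rfl⟩
  rw [div_eq_mul_inv]
  refine (regularAlong L).mul_mem (algebraMap_mem_regularAlong L g)
    (inv_formProd_mem_regularAlong fun M hM h => ?_)
  obtain ⟨c, rfl⟩ := exists_eq_smul_of_projPerp_eq_zero h
  have hc : c ≠ 0 := fun h0 => hs _ hM (by simp [h0])
  refine hL ?_
  rw [← inv_smul_smul₀ hc L]
  exact Submodule.smul_mem _ _ (Submodule.subset_span hM)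

/-- The fractions whose principal part along `L = 0` has coefficients in `polarAlong U`, independent
of `L`. -/
def expandable (L : E.Forms) (U : Submodule ℝ E.Forms) : Submodule ℝ E.Frac where
  carrier := {x | ∃ r : ℕ →₀ E.Frac, (∀ i, r i ∈ polarAlong U ⊓ fixedFrac L) ∧
    x - principalPart L r ∈ regularAlong L}
  add_mem' := by
    rintro x y ⟨r, hr, hx⟩ ⟨q, hq, hy⟩
    refine ⟨r + q, fun i => add_mem (hr i) (hq i), ?_⟩
    rw [map_add, add_sub_add_comm]
    exact add_mem hx hy
  zero_mem' := ⟨0, fun i => zero_mem _, by simp⟩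
  smul_mem' := by
    rintro c x ⟨r, hr, hx⟩
    refine ⟨c • r, fun i => Submodule.smul_mem _ c (hr i), ?_⟩
    rw [LinearMap.map_smul_of_tower, ← smul_sub]
    exact (regularAlong L).smul_mem hx c

theorem regularAlong_le_expandable (L : E.Forms) (U : Submodule ℝ E.Forms) :
    Subalgebra.toSubmodule (regularAlong L) ≤ expandable L U :=
  fun x hx => ⟨0, fun i => zero_mem _, by simpa using hx⟩

theorem formGerm_eq_smul_add (c : ℝ) (L M : E.Forms) :
    E.formGerm (c • L + M) = c • E.formGerm L + E.formGerm M := by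
  simp only [← formLin_apply, map_add, map_smul]

theorem div_eq_sub_of_eq_add {K : Type*} [Field K] {l m m' c : K} (g s t : K) (a : ℕ)
    (hm : m = c * l + m') (hl : l ≠ 0) (hm0 : m ≠ 0) (hm0' : m' ≠ 0) :
    g / (l ^ (a + 1) * (m * s) * t) =
      g / (l ^ (a + 1) * s * (m' * t)) - c * (g / (l ^ a * (m * s) * (m' * t))) := by
  by_cases hs : s = 0
  · simp [hs]
  by_cases ht : t = 0
  · simp [ht]
  rw [show c = (m - m') / l by rw [hm]; field_simp; ring]
  field_simp
  ring

/-- The expansion of a fraction along `L = 0`. The forms in `S` depend on `L`, those in `T` do not;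
the step replaces `1 / M` by `1 / M' - c L / (M M')`, where `M = M' + c L`. -/
theorem div_mem_expandable {W : Submodule ℝ E.Forms} {L : E.Forms} (h0 : L ≠ 0) (hL : L ∈ W)
    {g : E.Hol} (hg : E.IsHolIn (fun ℓ => ℓ ∈ Wᗮ) g.1) (a : ℕ) (S T : Multiset E.Forms)
    (hS : ∀ M ∈ S, (projPerp L).toLin M ≠ 0) (hT : ∀ M ∈ T, M ≠ 0)
    (hspan : Submodule.span ℝ {M | M ∈ T ∨ ∃ M' ∈ S, (projPerp L).toLin M' = M} = perpIn W L) :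
    algebraMap E.Hol E.Frac g / (algebraMap E.Hol E.Frac (E.formGerm L) ^ a *
      algebraMap E.Hol E.Frac (E.formProd S) * algebraMap E.Hol E.Frac (E.formProd T)) ∈
      expandable L (perpIn W L) := by
  have hL1 := algebraMap_frac_ne_zero (formGerm_ne_zero E h0)
  have hfixT : ∀ S T : Multiset E.Forms,
      Submodule.span ℝ {M | M ∈ T ∨ ∃ M' ∈ S, (projPerp L).toLin M' = M} = perpIn W L →
      ∀ M ∈ T, (projPerp L).toLin M = M := fun S T hspan M hM =>
    projPerp_of_mem_perpIn (W := W) (hspan ▸ Submodule.subset_span (Or.inl hM))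
  induction a generalizing S T with
  | zero =>
    refine regularAlong_le_expandable L _ ?_
    rw [pow_zero, one_mul, div_eq_mul_inv, mul_inv]
    refine (regularAlong L).mul_mem (algebraMap_mem_regularAlong L g)
      ((regularAlong L).mul_mem (inv_formProd_mem_regularAlong hS)
        (inv_formProd_mem_regularAlong fun M hM => ?_))
    rw [hfixT S T hspan M hM]
    exact hT M hM
  | succ a iha =>
    induction S using Multiset.induction_on generalizing T with
    | empty =>
      have hfix := hfixT 0 T hspan
      simp only [Multiset.notMem_zero, false_and, exists_false, or_false] at hspan
      refine ⟨Finsupp.single a (algebraMap E.Hol E.Frac g / algebraMap E.Hol E.Frac (E.formProd T)),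
        fun i => ?_, ?_⟩
      · rw [Finsupp.single_apply]
        split_ifs
        · refine ⟨Submodule.subset_span ⟨g, T, hg.mono fun ℓ hℓ =>
            Submodule.orthogonal_le inf_le_left hℓ, hT, hspan, rfl⟩, g, E.formProd T,
            formProd_ne_zero hT, ?_, ?_, rfl⟩
          · refine AdjointPair.pull_eq_self _ (fun ℓ hℓ => dilation_of_mem_orthogonal 0 ?_) hg
            exact Submodule.orthogonal_le (by simpa using hL) hℓ
          · rw [pull_formProd, Multiset.map_congr rfl hfix, Multiset.map_id']
        · exact zero_mem _
      · have hT1 := algebraMap_frac_ne_zero (formProd_ne_zero hT)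
        convert (regularAlong L).zero_mem using 1
        rw [principalPart, Finsupp.linearCombination_single, formProd_zero, map_one, smul_eq_mul,
          sub_eq_zero, inv_pow]
        field_simp
    | cons M S ihS =>
      obtain ⟨c, hc⟩ := exists_eq_smul_add_projPerp L M
      set M' := (projPerp L).toLin M with hM'
      have hM'0 : M' ≠ 0 := hS M (Multiset.mem_cons_self M S)
      have hM0 : M ≠ 0 := fun h => hM'0 (by rw [hM', h, map_zero])
      have e1 := algebraMap_frac_ne_zero (formGerm_ne_zero E hM0)
      have e2 := algebraMap_frac_ne_zero (formGerm_ne_zero E hM'0)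
      have hT' : ∀ N ∈ M' ::ₘ T, N ≠ 0 := by
        intro N hN
        rcases Multiset.mem_cons.1 hN with rfl | hN
        exacts [hM'0, hT N hN]
      have eM : algebraMap E.Hol E.Frac (E.formGerm M) =
          algebraMap ℝ E.Frac c * algebraMap E.Hol E.Frac (E.formGerm L) +
            algebraMap E.Hol E.Frac (E.formGerm M') := by
        conv_lhs => rw [hc, formGerm_eq_smul_add, map_add, Algebra.smul_def, map_mul,
          ← IsScalarTower.algebraMap_apply]
      have h1 := ihS (M' ::ₘ T) (fun N hN => hS N (Multiset.mem_cons_of_mem hN)) hT' (by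
        rw [← hspan]
        congr 1
        ext N
        simp only [Multiset.mem_cons, Set.mem_ofPred_eq, exists_eq_or_imp, ← hM', eq_comm (a := N)]
        rw [or_right_comm, or_comm, or_left_comm])
      have h2 := iha (M ::ₘ S) (M' ::ₘ T) hS hT' (by
        rw [← hspan]
        congr 1
        ext N
        simp only [Multiset.mem_cons, Set.mem_ofPred_eq, exists_eq_or_imp, ← hM', eq_comm (a := N)]
        rw [or_assoc, or_left_comm (b := N ∈ T), or_self_left])
      have := sub_mem h1 (Submodule.smul_mem _ c h2)
      convert this using 1
      rw [Algebra.smul_def, formProd_cons, formProd_cons, map_mul, map_mul]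
      exact div_eq_sub_of_eq_add _ _ _ a eM hL1 e1 e2

theorem polarAlong_le_expandable {W : Submodule ℝ E.Forms} {L : E.Forms} (h0 : L ≠ 0)
    (hL : L ∈ W) : polarAlong W ≤ expandable L (perpIn W L) := by
  classical
  refine Submodule.span_le.2 ?_
  rintro _ ⟨g, s, hg, hs, hspan, rfl⟩
  let S := s.filter fun M => (projPerp L).toLin M ≠ 0
  have hpar : ∀ t : Multiset E.Forms, (∀ M ∈ t, M ≠ 0 ∧ (projPerp L).toLin M = 0) →
      ∃ c : ℝ, c ≠ 0 ∧ E.formProd t = c • E.formGerm L ^ t.card := by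
    intro t
    induction t using Multiset.induction_on with
    | empty => exact fun _ => ⟨1, one_ne_zero, by simp [formProd_zero]⟩
    | cons M t ih =>
      intro ht
      obtain ⟨c, hc, e⟩ := ih fun N hN => ht N (Multiset.mem_cons_of_mem hN)
      obtain ⟨hM, hM'⟩ := ht M (Multiset.mem_cons_self M t)
      obtain ⟨d, rfl⟩ := exists_eq_smul_of_projPerp_eq_zero hM'
      refine ⟨d * c, mul_ne_zero (fun h => hM (by simp [h])) hc, ?_⟩
      have : E.formGerm (d • L) = d • E.formGerm L := map_smul E.formLin d L
      rw [formProd_cons, e, this, Multiset.card_cons, smul_mul_smul_comm, pow_succ']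
  obtain ⟨c, hc, e⟩ := hpar (s.filter fun M => ¬ (projPerp L).toLin M ≠ 0) fun M hM => by
    rw [Multiset.mem_filter] at hM
    exact ⟨hs M hM.1, not_not.1 hM.2⟩
  have hprod : E.formProd s = c • (E.formGerm L ^ (s.filter fun M =>
      ¬ (projPerp L).toLin M ≠ 0).card * E.formProd S * E.formProd 0) := by
    conv_lhs => rw [← Multiset.filter_add_not (fun M => (projPerp L).toLin M ≠ 0) s, formProd_add, e]
    rw [formProd_zero, mul_one, mul_comm, smul_mul_assoc]
  have h1 := div_mem_expandable h0 hL hg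
    (s.filter fun M => ¬ (projPerp L).toLin M ≠ 0).card S 0
    (fun M hM => (Multiset.mem_filter.1 hM).2) (fun M hM => absurd hM (Multiset.notMem_zero M)) ?_
  · have heq : algebraMap E.Hol E.Frac g / algebraMap E.Hol E.Frac (E.formProd s) = c⁻¹ •
        (algebraMap E.Hol E.Frac g / (algebraMap E.Hol E.Frac (E.formGerm L) ^
          (s.filter fun M => ¬ (projPerp L).toLin M ≠ 0).card *
          algebraMap E.Hol E.Frac (E.formProd S) * algebraMap E.Hol E.Frac (E.formProd 0))) := by
      rw [hprod, Algebra.smul_def, Algebra.smul_def, map_mul, map_mul, map_mul, map_pow, map_inv₀,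
        ← IsScalarTower.algebraMap_apply, ← div_div, div_eq_inv_mul _ (algebraMap ℝ E.Frac c),
        mul_div_assoc]
    rw [heq]
    exact Submodule.smul_mem _ c⁻¹ h1
  · refine le_antisymm (Submodule.span_le.2 ?_) fun u hu => ?_
    · rintro _ (hM | ⟨M, hM, rfl⟩)
      · exact absurd hM (Multiset.notMem_zero _)
      · exact projPerp_mem_perpIn hL (hspan ▸ Submodule.subset_span (Multiset.mem_filter.1 hM).1)
    · rw [← projPerp_of_mem_perpIn hu]
      have hle : W ≤ (Submodule.span ℝ {M | M ∈ (0 : Multiset E.Forms) ∨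
          ∃ M' ∈ S, (projPerp L).toLin M' = M}).comap (projPerp L).toLin := by
        rw [← hspan]
        refine Submodule.span_le.2 fun M hM => ?_
        by_cases h : (projPerp L).toLin M = 0
        · rw [SetLike.mem_coe, Submodule.mem_comap, h]
          exact zero_mem _
        · exact Submodule.subset_span (Or.inr ⟨M, Multiset.mem_filter.2 ⟨hM, h⟩, rfl⟩)
      exact hle hu.1

/-! ### Eigenvalues of contractions -/

/-- A germ that a contraction along `W` multiplies by `2 ^ n > 1` vanishes: on a neighbourhood of
`0` stable under the contraction it is bounded, and its values grow by `2 ^ n` in every step. -/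
theorem eq_zero_of_pull_dilation_eq (W : Submodule ℝ E.Forms) [FiniteDimensional ℝ W] {n : ℕ}
    (hn : n ≠ 0) (g : E.Hol) (h : (E.dilation (1 / 2) W).pull g = (2 : ℝ) ^ n • g) : g = 0 := by
  obtain ⟨k, u, ℓ, ha, -, -, e⟩ := g.2
  set τ := E.dilation (1 / 2) W with hτ
  let f : CInf → ℂ := fun z => u fun i => E.cval (ℓ i) z
  let T : CInf → CInf := E.complexMap τ.adj
  have h1 : ∀ᶠ z in E.nhd, f (T z) = 2 ^ n * f z := by
    have h2 := congrArg Subtype.val h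
    have h3 : ((2 : ℝ) ^ n • g).1 = (2 : ℝ) ^ n • g.1 := rfl
    rw [AdjointPair.pull_val, h3, e] at h2
    filter_upwards [Germ.coe_eq.1 h2] with z hz
    have hz' : f (T z) = ((2 : ℝ) ^ n : ℝ) • f z := hz
    rw [hz', Complex.real_smul]
    push_cast
    rfl
  have h2 : ∀ᶠ z in E.nhd, ‖f z‖ ≤ ‖u 0‖ + 1 :=
    (E.tendsto_cval_pi ℓ).eventually
      (ha.continuousAt.norm.tendsto.eventually_le_const (lt_add_one ‖u 0‖))
  obtain ⟨t, ε, hε, ht⟩ := E.exists_finset_of_mem_nhd (h1.and h2)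
  -- The neighbourhood is described by forms on which the contraction acts by `1 / 2` or by `1`.
  let U : Set CInf := {z | ∀ m ∈ t, ‖E.cval (W.starProjection m) z‖ < ε / 2 ∧
    ‖E.cval (m - W.starProjection m) z‖ < ε / 2}
  have hU : ∀ᶠ z in E.nhd, z ∈ U := by
    refine (Filter.eventually_all_finset t).2 fun m _ => ?_
    have hb : Metric.ball (0 : ℂ) (ε / 2) ∈ 𝓝 (0 : ℂ) := Metric.ball_mem_nhds _ (by positivity)
    filter_upwards [E.tendsto_cval (W.starProjection m) hb,
      E.tendsto_cval (m - W.starProjection m) hb] with z h3 h4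
    exact ⟨by simpa using h3, by simpa using h4⟩
  have hUsub : ∀ z ∈ U, f (T z) = 2 ^ n * f z ∧ ‖f z‖ ≤ ‖u 0‖ + 1 := fun z hz => ht fun m hm => by
    obtain ⟨h3, h4⟩ := hz m hm
    have : E.cval m z = E.cval (W.starProjection m) z + E.cval (m - W.starProjection m) z := by
      rw [← cval_add, add_sub_cancel]
    rw [this]
    exact (norm_add_le _ _).trans_lt (by linarith)
  have hUT : ∀ z ∈ U, T z ∈ U := fun z hz m hm => by
    obtain ⟨h3, h4⟩ := hz m hm
    simp only [T, AdjointPair.cval_complexMap, hτ]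
    rw [dilation_of_mem _ (W.starProjection_apply_mem m),
      dilation_of_mem_orthogonal _ (Submodule.sub_starProjection_mem_orthogonal m), cval_smul]
    refine ⟨?_, h4⟩
    rw [norm_mul]
    have : ‖((1 / 2 : ℝ) : ℂ)‖ = 1 / 2 := by norm_num
    rw [this]
    linarith [norm_nonneg (E.cval (W.starProjection m) z)]
  refine Subtype.ext (e.trans (Germ.coe_eq.2 ?_))
  filter_upwards [hU] with z hz
  have hiter : ∀ k : ℕ, T^[k] z ∈ U ∧ f (T^[k] z) = (2 ^ n) ^ k * f z := by
    intro k
    induction k with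
    | zero => exact ⟨hz, by simp⟩
    | succ k ih =>
      rw [Function.iterate_succ_apply']
      refine ⟨hUT _ ih.1, ?_⟩
      rw [(hUsub _ ih.1).1, ih.2, pow_succ']
      ring
  by_contra h0
  have h0' : 0 < ‖f z‖ := norm_pos_iff.2 h0
  have h2n : (1 : ℝ) < 2 ^ n := one_lt_pow₀ one_lt_two hn
  obtain ⟨k, hk⟩ := pow_unbounded_of_one_lt ((‖u 0‖ + 1) / ‖f z‖) h2n
  rw [div_lt_iff₀ h0'] at hk
  have h5 := (hUsub _ (hiter k).1).2
  rw [(hiter k).2, norm_mul, norm_pow, norm_pow, Complex.norm_ofNat] at h5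
  linarith

theorem pull_dilation_injective (W : Submodule ℝ E.Forms) [FiniteDimensional ℝ W] :
    Function.Injective (E.dilation (1 / 2) W).pull := by
  refine Function.LeftInverse.injective (g := (E.dilation 2 W).pull) fun g => ?_
  refine AdjointPair.pull_pull_of_leftInverse _ _ (fun ℓ => ?_) g
  have h : (E.dilation (1 / 2) W).toLin ℓ = (1 / 2 : ℝ) • W.starProjection ℓ +
      (ℓ - W.starProjection ℓ) := by
    rw [dilation_apply]
    module
  rw [h, map_add, map_smul, dilation_of_mem _ (W.starProjection_apply_mem ℓ),
    dilation_of_mem_orthogonal _ (Submodule.sub_starProjection_mem_orthogonal ℓ)]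
  module

/-- The contraction by `1 / 2` along `W`, on fractions. -/
def fracDilation (W : Submodule ℝ E.Forms) [FiniteDimensional ℝ W] : E.Frac →ₐ[ℝ] E.Frac :=
  IsFractionRing.liftAlgHom (K := E.Frac)
    (g := (IsScalarTower.toAlgHom ℝ E.Hol E.Frac).comp (E.dilation (1 / 2) W).pull)
    ((IsFractionRing.injective E.Hol E.Frac).comp (pull_dilation_injective W))

theorem fracDilation_algebraMap (W : Submodule ℝ E.Forms) [FiniteDimensional ℝ W] (g : E.Hol) :
    fracDilation W (algebraMap E.Hol E.Frac g) =
      algebraMap E.Hol E.Frac ((E.dilation (1 / 2) W).pull g) :=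
  IsLocalization.lift_eq _ g

open Polynomial in
theorem aeval_fracDilation_algebraMap (W : Submodule ℝ E.Forms) [FiniteDimensional ℝ W]
    (p : ℝ[X]) (g : E.Hol) :
    aeval (fracDilation W).toLinearMap p (algebraMap E.Hol E.Frac g) =
      algebraMap E.Hol E.Frac (aeval (E.dilation (1 / 2) W).pull.toLinearMap p g) := by
  induction p using Polynomial.induction_on generalizing g with
  | C r =>
    simp only [aeval_C, Module.algebraMap_end_apply]
    rw [Algebra.smul_def, Algebra.smul_def, map_mul, ← IsScalarTower.algebraMap_apply]
  | add p q hp hq => simp only [map_add, LinearMap.add_apply, hp, hq]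
  | monomial n r ih =>
    rw [pow_succ, ← mul_assoc, map_mul (aeval (fracDilation W).toLinearMap) (C r * X ^ n) X,
      map_mul (aeval (E.dilation (1 / 2) W).pull.toLinearMap) (C r * X ^ n) X, aeval_X, aeval_X,
      Module.End.mul_apply, Module.End.mul_apply, AlgHom.toLinearMap_apply, AlgHom.toLinearMap_apply,
      fracDilation_algebraMap, ih]

open Polynomial in
/-- A polar germ is not holomorphic: the contraction along the span `W` of its denominators
multiplies its components by powers `2 ^ n` with `n ≥ 1`, which are not eigenvalues on holomorphic
germs. -/
theorem eq_zero_of_algebraMap_mem_polarAlong {W : Submodule ℝ E.Forms} [FiniteDimensional ℝ W]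
    (hW : W ≠ ⊥) {g : E.Hol} (hg : algebraMap E.Hol E.Frac g ∈ polarAlong W) : g = 0 := by
  let S : Submonoid ℝ[X] := Submonoid.closure {p | ∃ n : ℕ, n ≠ 0 ∧ p = X - C (2 ^ n)}
  have hinj : ∀ p ∈ S, Function.Injective (aeval (E.dilation (1 / 2) W).pull.toLinearMap p) := by
    intro p hp
    induction hp using Submonoid.closure_induction with
    | mem p hp =>
      obtain ⟨n, hn, rfl⟩ := hp
      refine (injective_iff_map_eq_zero _).2 fun g hg => ?_
      refine eq_zero_of_pull_dilation_eq W hn g ?_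
      rwa [map_sub, aeval_X, aeval_C, LinearMap.sub_apply, AlgHom.toLinearMap_apply,
        Module.algebraMap_end_apply, sub_eq_zero] at hg
    | one =>
      rw [map_one]
      exact Function.injective_id
    | mul p q _ _ hp hq =>
      rw [map_mul]
      exact hp.comp hq
  have hann : ∀ x ∈ polarAlong W, ∃ p ∈ S, aeval (fracDilation W).toLinearMap p x = 0 := by
    intro x hx
    induction hx using Submodule.span_induction with
    | mem x h =>
      obtain ⟨g, s, hg, hs, hspan, rfl⟩ := h
      have hs0 : s.card ≠ 0 := fun h0 => hW <| by
        rw [← hspan, Multiset.card_eq_zero.1 h0]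
        simp
      refine ⟨_, Submonoid.subset_closure ⟨s.card, hs0, rfl⟩, ?_⟩
      have h1 : (E.dilation (1 / 2) W).pull g = g :=
        AdjointPair.pull_eq_self _ (fun ℓ hℓ => dilation_of_mem_orthogonal _ hℓ) hg
      have h2 : ∀ t : Multiset E.Forms, (∀ L ∈ t, L ∈ W) → (E.dilation (1 / 2) W).pull (E.formProd t) =
          ((1 / 2 : ℝ) ^ t.card) • E.formProd t := by
        intro t
        induction t using Multiset.induction_on with
        | empty => simp [formProd_zero]
        | cons L t ih =>
          intro ht
          have h3 : E.formGerm ((1 / 2 : ℝ) • L) = (1 / 2 : ℝ) • E.formGerm L :=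
            map_smul E.formLin _ L
          rw [formProd_cons, map_mul, ih fun M hM => ht M (Multiset.mem_cons_of_mem hM),
            AdjointPair.pull_formGerm, dilation_of_mem _ (ht L (Multiset.mem_cons_self L t)), h3,
            smul_mul_smul_comm, Multiset.card_cons, pow_succ']
      have h4 := h2 s fun L hL => hspan ▸ Submodule.subset_span hL
      have h5 : fracDilation W (algebraMap E.Hol E.Frac g / algebraMap E.Hol E.Frac (E.formProd s)) =
          (2 : ℝ) ^ s.card •
            (algebraMap E.Hol E.Frac g / algebraMap E.Hol E.Frac (E.formProd s)) := by
        rw [map_div₀, fracDilation_algebraMap, fracDilation_algebraMap, h1, h4, Algebra.smul_def,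
          Algebra.smul_def, map_mul, ← IsScalarTower.algebraMap_apply, one_div, inv_pow, map_inv₀,
          div_mul_eq_div_div, div_inv_eq_mul, mul_comm _ (algebraMap ℝ E.Frac _), mul_div_assoc]
      rw [map_sub, aeval_X, aeval_C, LinearMap.sub_apply, AlgHom.toLinearMap_apply, h5,
        Module.algebraMap_end_apply, sub_self]
    | zero => exact ⟨1, one_mem _, map_zero _⟩
    | add x y _ _ hx hy =>
      obtain ⟨p, hp, hpx⟩ := hx
      obtain ⟨q, hq, hqy⟩ := hy
      refine ⟨p * q, mul_mem hp hq, ?_⟩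
      have e1 : aeval (fracDilation W).toLinearMap (p * q) x = 0 := by
        rw [mul_comm, map_mul, Module.End.mul_apply, hpx, map_zero]
      have e2 : aeval (fracDilation W).toLinearMap (p * q) y = 0 := by
        rw [map_mul, Module.End.mul_apply, hqy, map_zero]
      rw [map_add, e1, e2, add_zero]
    | smul c x _ hx =>
      obtain ⟨p, hp, hpx⟩ := hx
      exact ⟨p, hp, by rw [map_smul, hpx, smul_zero]⟩
  obtain ⟨p, hp, hpg⟩ := hann _ hg
  rw [aeval_fracDilation_algebraMap, map_eq_zero_iff _ (IsFractionRing.injective E.Hol E.Frac)] at hpg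
  exact hinj p hp (hpg.trans (map_zero _).symm)

/-! ### Independence of the spaces of polar germs -/

theorem exists_eq_div_formProd {W : Submodule ℝ E.Forms} {x : E.Frac} (hx : x ∈ polarAlong W) :
    ∃ (a : E.Hol) (s : Multiset E.Forms), (∀ L ∈ s, L ≠ 0) ∧
      x = algebraMap E.Hol E.Frac a / algebraMap E.Hol E.Frac (E.formProd s) := by
  induction hx using Submodule.span_induction with
  | mem x h =>
    obtain ⟨g, s, -, hs, -, rfl⟩ := h
    exact ⟨g, s, hs, rfl⟩
  | zero => exact ⟨0, 0, by simp, by simp⟩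
  | add x y _ _ hx hy =>
    obtain ⟨a, s, hs, rfl⟩ := hx
    obtain ⟨b, t, ht, rfl⟩ := hy
    refine ⟨a * E.formProd t + E.formProd s * b, s + t, fun L hL => ?_, ?_⟩
    · rcases Multiset.mem_add.1 hL with h | h
      exacts [hs L h, ht L h]
    · rw [div_add_div _ _ (algebraMap_frac_ne_zero (formProd_ne_zero hs))
        (algebraMap_frac_ne_zero (formProd_ne_zero ht)), formProd_add]
      simp only [map_add, map_mul]
  | smul c x _ hx =>
    obtain ⟨a, s, hs, rfl⟩ := hx
    refine ⟨c • a, s, hs, ?_⟩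
    rw [Algebra.smul_def, Algebra.smul_def, map_mul, ← IsScalarTower.algebraMap_apply,
      mul_div_assoc]

/-- The spaces of polar germs with different spans of denominators are independent. If the members
of a family add up to zero, their principal parts along `L = 0` cancel, so that they vanish by
induction on the dimension. Hence each member is regular along every hyperplane. -/
theorem eq_zero_of_sum_eq_zero {ι : Type*} (n : ℕ) (s : Finset ι) (W : ι → Submodule ℝ E.Forms)
    (hfin : ∀ i, FiniteDimensional ℝ (W i)) (hW : Set.InjOn W s)
    (hn : ∀ i ∈ s, Module.finrank ℝ (W i) < n)
    (f : ι → E.Frac) (hf : ∀ i ∈ s, f i ∈ polarAlong (W i)) (hsum : ∑ i ∈ s, f i = 0) :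
    ∀ i ∈ s, f i = 0 := by
  classical
  induction n generalizing s W f with
  | zero => exact fun i hi => absurd (hn i hi) (Nat.not_lt_zero _)
  | succ n ih =>
    have hreg : ∀ L : E.Forms, L ≠ 0 → ∀ i ∈ s, f i ∈ regularAlong L := by
      intro L hL
      have hout : ∀ i ∈ s, L ∉ W i → f i ∈ regularAlong L := fun i hi h =>
        polarAlong_le_regularAlong h (hf i hi)
      set t := s.filter fun i => L ∈ W i with ht
      have hts : ∀ i ∈ t, i ∈ s ∧ L ∈ W i := fun i hi => Finset.mem_filter.1 hi
      have hex : ∀ i ∈ t, ∃ r : ℕ →₀ E.Frac, (∀ k, r k ∈ polarAlong (perpIn (W i) L) ⊓ fixedFrac L) ∧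
          f i - principalPart L r ∈ regularAlong L := fun i hi =>
        polarAlong_le_expandable hL (hts i hi).2 (hf i (hts i hi).1)
      choose! r hr hfr using hex
      have htsum : ∑ i ∈ t, f i ∈ regularAlong L := by
        rw [← Finset.sum_filter_add_sum_filter_not s (fun i => L ∈ W i), add_eq_zero_iff_eq_neg]
          at hsum
        rw [hsum]
        refine neg_mem (sum_mem fun i hi => ?_)
        rw [Finset.mem_filter] at hi
        exact hout i hi.1 hi.2
      have hr0 : ∑ i ∈ t, r i = 0 := by
        refine eq_zero_of_principalPart_mem hL (fun k => ?_) ?_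
        · rw [Finsupp.finsetSum_apply]
          exact sum_mem fun i hi => (hr i hi k).2
        · have := sub_mem htsum (sum_mem hfr)
          rw [← Finset.sum_sub_distrib] at this
          simpa only [sub_sub_cancel, map_sum] using this
      have hinj : Set.InjOn (fun i => perpIn (W i) L) t := by
        intro i hi j hj hij
        refine hW (hts i hi).1 (hts j hj).1 ?_
        rw [← perpIn_sup (hts i hi).2, ← perpIn_sup (hts j hj).2]
        exact congrArg (· ⊔ ℝ ∙ L) hij
      have hrk : ∀ k, ∀ i ∈ t, r i k = 0 := fun k => by
        refine ih t (fun i => perpIn (W i) L) (fun i => inferInstance) hinj (fun i hi => ?_)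
          (fun i => r i k) (fun i hi => (hr i hi k).1) ?_
        · have h1 := finrank_perpIn_lt (hts i hi).2 hL
          have h2 := hn i (hts i hi).1
          omega
        · rw [← Finsupp.finsetSum_apply, hr0, Finsupp.zero_apply]
      intro i hi
      by_cases h : L ∈ W i
      · have hit : i ∈ t := Finset.mem_filter.2 ⟨hi, h⟩
        have : r i = 0 := Finsupp.ext fun k => hrk k i hit
        have h3 := hfr i hit
        rwa [this, map_zero, sub_zero] at h3
      · exact hout i hi h
    have hne : ∀ i ∈ s, W i ≠ ⊥ → f i = 0 := by
      intro i hi hWi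
      obtain ⟨a, d, hd, e⟩ := exists_eq_div_formProd (hf i hi)
      obtain ⟨g, hg⟩ := exists_eq_algebraMap_of_regularAlong d hd a fun L hL => e ▸ hreg L hL i hi
      have := hf i hi
      rw [e, hg] at this ⊢
      rw [eq_zero_of_algebraMap_mem_polarAlong hWi this, map_zero]
    intro i hi
    by_cases hWi : W i = ⊥
    · rw [← hsum]
      refine (Finset.sum_eq_single_of_mem i hi fun j hj hji => hne j hj fun hWj => hji ?_).symm
      exact hW hj hi (hWj.trans hWi.symm)
    · exact hne i hi hWi

/-! ### Uniqueness of the decomposition -/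

variable (E) in
/-- The inclusion of `ℳ` into the field of fractions. -/
def merToFrac : E.Mer →ₐ[ℝ] E.Frac :=
  IsLocalization.liftAlgHom (M := E.poles) (f := IsScalarTower.toAlgHom ℝ E.Hol E.Frac) fun y => by
    have hy : y.1 ≠ 0 := by
      have : E.poles ≤ nonZeroDivisors E.Hol := Submonoid.closure_le.2 <| by
        rintro _ ⟨L, hL, rfl⟩
        exact mem_nonZeroDivisors_of_ne_zero (formGerm_ne_zero E hL)
      exact nonZeroDivisors.ne_zero (this y.2)
    exact (algebraMap_frac_ne_zero hy).isUnit

theorem merToFrac_algebraMap (g : E.Hol) :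
    E.merToFrac (algebraMap E.Hol E.Mer g) = algebraMap E.Hol E.Frac g :=
  IsLocalization.lift_eq _ g

theorem merToFrac_mk (g : E.Hol) (y : E.poles) :
    E.merToFrac (Localization.mk g y) =
      algebraMap E.Hol E.Frac g / algebraMap E.Hol E.Frac y := by
  have h1 : Localization.mk g y * algebraMap E.Hol E.Mer y = algebraMap E.Hol E.Mer g := by
    rw [Localization.mk_eq_mk', IsLocalization.mk'_spec]
  have h2 := congrArg E.merToFrac h1
  rw [map_mul, merToFrac_algebraMap, merToFrac_algebraMap] at h2
  refine eq_div_of_mul_eq (fun h0 => ?_) h2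
  have : IsUnit (algebraMap E.Hol E.Mer y) := IsLocalization.map_units E.Mer y
  have := this.map E.merToFrac
  rw [merToFrac_algebraMap, h0] at this
  exact not_isUnit_zero this

theorem polar_le_comap : E.Polar ≤
    (⨆ (W : {W : Submodule ℝ E.Forms // FiniteDimensional ℝ W}) (_ : W ≠ ⟨⊥, inferInstance⟩),
      polarAlong W.1).comap E.merToFrac.toLinearMap := by
  refine Submodule.span_le.2 ?_
  rintro _ ⟨n, L, hL, g, hn, hg, rfl⟩
  let W := Submodule.span ℝ (Set.range L)
  have hW : FiniteDimensional ℝ W := FiniteDimensional.span_of_finite ℝ (Set.finite_range L)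
  have hbot : (⟨W, hW⟩ : {W : Submodule ℝ E.Forms // FiniteDimensional ℝ W}) ≠
      ⟨⊥, inferInstance⟩ := fun h => by
    have h1 : W = ⊥ := congrArg Subtype.val h
    have h2 : L ⟨0, hn⟩ ∈ W := Submodule.subset_span ⟨_, rfl⟩
    rw [h1, Submodule.mem_bot] at h2
    exact hL _ h2
  refine Submodule.mem_iSup_of_mem ⟨W, hW⟩ (Submodule.mem_iSup_of_mem hbot ?_)
  refine Submodule.subset_span ⟨g, Multiset.map L Finset.univ.val, ?_, ?_, ?_, ?_⟩
  · refine IsHolIn.mono (fun ℓ hℓ => ?_) hg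
    rw [Submodule.mem_orthogonal']
    intro u hu
    have : W ≤ LinearMap.ker (innerₛₗ ℝ ℓ) := Submodule.span_le.2 <| by
      rintro _ ⟨j, rfl⟩
      exact hℓ j
    exact this hu
  · simpa using hL
  · congr 1
    ext
    simp
  · rw [AlgHom.toLinearMap_apply, merToFrac_mk]
    simp only [formProd, Multiset.map_map, Finset.prod]
    rfl

/-- A holomorphic germ that is a sum of polar germs vanishes. -/
theorem eq_zero_of_algebraMap_mem_polar {g : E.Hol} (hg : algebraMap E.Hol E.Mer g ∈ E.Polar) :
    g = 0 := by
  have h1 := polar_le_comap hg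
  rw [Submodule.mem_comap, AlgHom.toLinearMap_apply, merToFrac_algebraMap] at h1
  have h2 : algebraMap E.Hol E.Frac g ∈ polarAlong (⊥ : Submodule ℝ E.Forms) :=
    Submodule.subset_span ⟨g, 0, IsHolIn.mono (P := fun _ => True) (fun ℓ _ => by simp)
      (g := g.1) g.2, by simp, by simp,
      by simp [formProd_zero]⟩
  have hind : iSupIndep fun W : {W : Submodule ℝ E.Forms // FiniteDimensional ℝ W} =>
      polarAlong W.1 := by
    rw [iSupIndep_iff_finsetSum_eq_zero_imp_eq_zero]
    intro s v hv hsum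
    refine eq_zero_of_sum_eq_zero (s.sup (fun W => Module.finrank ℝ W.1) + 1) s (fun W => W.1)
      (fun W => W.2) Subtype.val_injective.injOn (fun W hW => ?_) v hv hsum
    exact Nat.lt_succ_of_le (Finset.le_sup (f := fun W => Module.finrank ℝ W.1) hW)
  have h3 := Submodule.disjoint_def.1 (hind ⟨⊥, inferInstance⟩) _ h2 h1
  rwa [map_eq_zero_iff _ (IsFractionRing.injective E.Hol E.Frac)] at h3

/-- The decomposition `ℳ = ℳ₊ ⊕ ℳ₋`. -/
theorem existsUnique_isHolPart (f : E.Mer) : ∃! g, E.IsHolPart f g := by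
  obtain ⟨g, hg⟩ := E.exists_isHolPart f
  refine ⟨g, hg, fun g' hg' => ?_⟩
  have h1 : f - algebraMap E.Hol E.Mer g ∈ E.Polar := hg
  have h2 : f - algebraMap E.Hol E.Mer g' ∈ E.Polar := hg'
  have h3 := E.Polar.add_mem h1 (E.Polar.smul_mem (-1 : ℝ) h2)
  have e : f - algebraMap E.Hol E.Mer g + (-1 : ℝ) • (f - algebraMap E.Hol E.Mer g') =
      algebraMap E.Hol E.Mer (g' - g) := by
    rw [map_sub, Algebra.smul_def, map_neg, map_one]
    ring
  rw [e] at h3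
  exact sub_eq_zero.1 (eq_zero_of_algebraMap_mem_polar h3)

/-! ### Similitudes -/

/-- Orthogonal families with the same norms correspond under an isometry of the whole space: a
product of reflections, each of which fixes the vectors already in place. -/
theorem exists_isometry_apply_eq {V : Type*} (a b : V → E.Forms) (s : Finset V)
    (ha : ∀ u v, u ≠ v → inner ℝ (a u) (a v) = 0) (hb : ∀ u v, u ≠ v → inner ℝ (b u) (b v) = 0)
    (hab : ∀ v, ‖a v‖ = ‖b v‖) : ∃ e : E.Forms ≃ₗᵢ[ℝ] E.Forms, ∀ v ∈ s, e (a v) = b v := by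
  classical
  induction s using Finset.induction_on with
  | empty => exact ⟨LinearIsometryEquiv.refl ℝ _, by simp⟩
  | insert u s hu ih =>
    obtain ⟨e, he⟩ := ih
    refine ⟨e.trans (ℝ ∙ (e (a u) - b u))ᗮ.reflection, fun v hv => ?_⟩
    rw [LinearIsometryEquiv.trans_apply]
    rcases Finset.mem_insert.1 hv with rfl | hv
    · exact Submodule.reflection_sub (by rw [e.norm_map, hab])
    · have huv : u ≠ v := fun h => hu (h ▸ hv)
      rw [he v hv]
      refine Submodule.reflection_mem_subspace_eq_self ?_
      rw [Submodule.mem_orthogonal_singleton_iff_inner_right, inner_sub_left, hb u v huv, ← he v hv,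
        e.inner_map_map, ha u v huv, sub_zero]

/-- A multiple of an isometry, with its adjoint. -/
def similitude (c : ℝ) (e : E.Forms ≃ₗᵢ[ℝ] E.Forms) : E.AdjointPair where
  toLin := c • e.toLinearEquiv.toLinearMap
  adj := c • e.symm.toLinearEquiv.toLinearMap
  inner_eq x y := by
    simp only [LinearMap.smul_apply, inner_smul_left, inner_smul_right]
    congr 1
    exact e.inner_map_eq_flip x y

theorem similitude_apply (c : ℝ) (e : E.Forms ≃ₗᵢ[ℝ] E.Forms) (x : E.Forms) :
    (similitude c e).toLin x = c • e x := rfl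

/-! ### The operators on monomials -/

theorem intOp_single (L ℓ : E.Forms) (a : E.Mer) :
    E.intOp L (AddMonoidAlgebra.single ℓ a) =
      AddMonoidAlgebra.single (ℓ - L) (a * E.piDivSin (L - ℓ)) := by
  rw [intOp, AddMonoidAlgebra.coeff_single, Finsupp.sum_single_index (by simp)]

theorem intOp_zero (L : E.Forms) : E.intOp L 0 = 0 := by
  simp [intOp]

theorem intOp_add (L : E.Forms) (x y : E.MerPow) :
    E.intOp L (x + y) = E.intOp L x + E.intOp L y := by
  rw [intOp, AddMonoidAlgebra.coeff_add, Finsupp.sum_add_index' (by simp)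
    (fun ℓ a b => by rw [add_mul, AddMonoidAlgebra.single_add])]
  rfl

/-! ### Substitution in meromorphic germs -/

namespace AdjointPair

variable (τ σ : E.AdjointPair)

/-- The substitution of an injective linear map of forms in meromorphic germs. -/
def pullMer (hτ : Function.Injective τ.toLin) : E.Mer →ₐ[ℝ] E.Mer :=
  IsLocalization.liftAlgHom (M := E.poles)
    (f := (IsScalarTower.toAlgHom ℝ E.Hol E.Mer).comp τ.pull) fun y => by
      have h : E.poles ≤ E.poles.comap τ.pull := Submonoid.closure_le.2 <| by
        rintro _ ⟨L, hL, rfl⟩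
        rw [SetLike.mem_coe, Submonoid.mem_comap, pull_formGerm]
        exact Submonoid.subset_closure ⟨_, fun h0 => hL (hτ (h0.trans (map_zero _).symm)), rfl⟩
      have hy : τ.pull y.1 ∈ E.poles := h y.2
      exact IsLocalization.map_units E.Mer (⟨τ.pull y.1, hy⟩ : E.poles)

variable {τ σ} (hτ : Function.Injective τ.toLin)

theorem pullMer_algebraMap (g : E.Hol) :
    τ.pullMer hτ (algebraMap E.Hol E.Mer g) = algebraMap E.Hol E.Mer (τ.pull g) :=
  IsLocalization.lift_eq _ g

theorem pullMer_mk (g : E.Hol) (y y' : E.poles) (hy : (y' : E.Hol) = τ.pull y) :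
    τ.pullMer hτ (Localization.mk g y) = Localization.mk (τ.pull g) y' := by
  have h1 : Localization.mk g y * algebraMap E.Hol E.Mer y = algebraMap E.Hol E.Mer g := by
    rw [Localization.mk_eq_mk', IsLocalization.mk'_spec]
  have h2 := congrArg (τ.pullMer hτ) h1
  rw [map_mul, pullMer_algebraMap, pullMer_algebraMap, ← hy] at h2
  exact (IsLocalization.eq_mk'_iff_mul_eq.2 h2).trans (Localization.mk_eq_mk'_apply _ _).symm

theorem pullMer_pullMer (hσ : Function.Injective σ.toLin)
    (h : ∀ ℓ, σ.toLin (τ.toLin ℓ) = ℓ) (f : E.Mer) :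
    σ.pullMer hσ (τ.pullMer hτ f) = f := by
  have : ((σ.pullMer hσ).comp (τ.pullMer hτ)).toRingHom = RingHom.id E.Mer := by
    refine IsLocalization.ringHom_ext E.poles (RingHom.ext fun g => ?_)
    change σ.pullMer hσ (τ.pullMer hτ (algebraMap E.Hol E.Mer g)) = algebraMap E.Hol E.Mer g
    rw [pullMer_algebraMap, pullMer_algebraMap, pull_pull_of_leftInverse _ _ h]
  exact RingHom.congr_fun this f

theorem pullMer_piDivSin (hσ : Function.Injective σ.toLin)
    (h : ∀ ℓ, σ.toLin (τ.toLin ℓ) = ℓ) (ℓ : E.Forms) :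
    τ.pullMer hτ (E.piDivSin ℓ) = E.piDivSin (τ.toLin ℓ) := by
  have hinv : ∀ x : E.Mer, τ.pullMer hτ (Ring.inverse x) = Ring.inverse (τ.pullMer hτ x) := by
    intro x
    by_cases hx : IsUnit x
    · obtain ⟨u, rfl⟩ := hx
      have : τ.pullMer hτ (u : E.Mer) = (Units.map (τ.pullMer hτ : E.Mer →* E.Mer) u : E.Mer) := rfl
      rw [this, Ring.inverse_unit, Ring.inverse_unit, ← map_inv]
      rfl
    -- At a nonunit `Ring.inverse` is `0`, and an automorphism preserves nonunits.
    · have hx' : ¬ IsUnit (τ.pullMer hτ x) := fun hu => hx <| by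
        have := hu.map (σ.pullMer hσ)
        rwa [pullMer_pullMer hτ hσ h] at this
      rw [Ring.inverse_non_unit _ hx, Ring.inverse_non_unit _ hx', map_zero]
  rw [piDivSin, map_smul, hinv, pullMer_algebraMap, pull_sinGerm]
  rfl

theorem pullMer_polar (hinner : ∀ x y, inner ℝ x y = (0 : ℝ) →
    inner ℝ (τ.toLin x) (τ.toLin y) = (0 : ℝ)) {f : E.Mer} (hf : f ∈ E.Polar) :
    τ.pullMer hτ f ∈ E.Polar := by
  have : E.Polar ≤ E.Polar.comap (τ.pullMer hτ).toLinearMap := by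
    refine Submodule.span_le.2 ?_
    rintro _ ⟨n, L, hL, g, hn, hg, rfl⟩
    have hL' : ∀ j, τ.toLin (L j) ≠ 0 := fun j h0 => hL j (hτ (h0.trans (map_zero _).symm))
    refine Submodule.subset_span ⟨n, fun j => τ.toLin (L j), hL', τ.pull g, hn,
      τ.pull_isHolIn (fun ℓ hℓ j => hinner _ _ (hℓ j)) hg, ?_⟩
    refine pullMer_mk hτ _ _ _ ?_
    simp only [map_prod, pull_formGerm]
  exact this hf

/-- A substitution that preserves orthogonality maps the decomposition of `f` to that of its
image. -/
theorem pullMer_isHolPart (hinner : ∀ x y, inner ℝ x y = (0 : ℝ) →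
    inner ℝ (τ.toLin x) (τ.toLin y) = (0 : ℝ)) {f : E.Mer} {g : E.Hol} (hf : E.IsHolPart f g) :
    E.IsHolPart (τ.pullMer hτ f) (τ.pull g) := by
  have := pullMer_polar hτ hinner hf
  rwa [map_sub, pullMer_algebraMap] at this

/-! ### Substitution in the group ring and in the branched integrals -/

/-- The substitution of an injective linear map of forms in the coefficients and the exponents of
an element of `ℳ[ℒ]`. -/
def pullPow : E.MerPow →+* E.MerPow :=
  AddMonoidAlgebra.liftNCRingHom
    (AddMonoidAlgebra.singleZeroRingHom.comp (τ.pullMer hτ).toRingHom)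
    ((AddMonoidAlgebra.of E.Mer E.Forms).comp (AddMonoidHom.toMultiplicative τ.toLin.toAddMonoidHom))
    fun _ _ => by
      rw [commute_iff_eq]
      exact mul_comm (G := E.MerPow) _ _

theorem pullPow_single (ℓ : E.Forms) (a : E.Mer) :
    pullPow hτ (AddMonoidAlgebra.single ℓ a) =
      AddMonoidAlgebra.single (τ.toLin ℓ) (τ.pullMer hτ a) := by
  refine (AddMonoidAlgebra.liftNC_single _ _ _ _).trans ?_
  change AddMonoidAlgebra.single 0 (τ.pullMer hτ a) * AddMonoidAlgebra.single (τ.toLin ℓ) 1 = _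
  rw [AddMonoidAlgebra.single_mul_single, zero_add, mul_one]

theorem pullPow_intOp (hσ : Function.Injective σ.toLin)
    (h : ∀ ℓ, σ.toLin (τ.toLin ℓ) = ℓ) (L : E.Forms) (x : E.MerPow) :
    pullPow hτ (E.intOp L x) = E.intOp (τ.toLin L) (pullPow hτ x) := by
  induction x using AddMonoidAlgebra.induction_linear with
  | zero => rw [intOp_zero, map_zero, intOp_zero]
  | add x y hx hy => rw [intOp_add, map_add, map_add, intOp_add, hx, hy]
  | single ℓ a =>
    rw [intOp_single, pullPow_single, pullPow_single, intOp_single, map_mul, map_sub,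
      pullMer_piDivSin hτ hσ h, map_sub]

theorem pullMer_evOne (x : E.MerPow) :
    τ.pullMer hτ (E.evOne x) = E.evOne (pullPow hτ x) := by
  have hadd : ∀ x y : E.MerPow, E.evOne (x + y) = E.evOne x + E.evOne y := fun x y => by
    rw [evOne, AddMonoidAlgebra.coeff_add, Finsupp.sum_add_index' (by simp) (by simp)]
    rfl
  have hsingle : ∀ (ℓ : E.Forms) (a : E.Mer), E.evOne (AddMonoidAlgebra.single ℓ a) = a :=
    fun ℓ a => by rw [evOne, AddMonoidAlgebra.coeff_single, Finsupp.sum_single_index rfl]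
  induction x using AddMonoidAlgebra.induction_linear with
  | zero => rw [map_zero]; simp [evOne]
  | add x y hx hy => rw [hadd, map_add, map_add, hadd, hx, hy]
  | single ℓ a => rw [hsingle, pullPow_single, hsingle]

variable {V : Type*} [Fintype V] [PartialOrder V]

theorem pullPow_treeR (hσ : Function.Injective σ.toLin)
    (h : ∀ ℓ, σ.toLin (τ.toLin ℓ) = ℓ) (d : V → E.Forms) (v : V) :
    pullPow hτ (E.treeR d v) = E.treeR (fun v => τ.toLin (d v)) v := by
  induction v using treeR.induct with
  | case1 v ih =>
    rw [treeR, treeR, pullPow_intOp hτ hσ h, map_prod]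
    simp only [ih]

/-- Substitution commutes with the operators `I^L` and with products, hence with `ℛ`; so no closed
formula for `ℛ` is needed. -/
theorem pullMer_forestR₁ (hσ : Function.Injective σ.toLin)
    (h : ∀ ℓ, σ.toLin (τ.toLin ℓ) = ℓ) (d : V → E.Forms) :
    τ.pullMer hτ (E.forestR₁ d) = E.forestR₁ fun v => τ.toLin (d v) := by
  rw [forestR₁, pullMer_evOne, forestR₁, forestR, forestR, map_prod]
  simp only [pullPow_treeR hτ hσ h]

end AdjointPair

theorem renormalised_eq_of_similar {V : Type*} [Fintype V] [PartialOrder V] {d₁ d₂ : V → E.Forms}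
    (h₁ : ∀ u v, u ≠ v → E.formQ (d₁ u) (d₁ v) = 0)
    (h₂ : ∀ u v, u ≠ v → E.formQ (d₂ u) (d₂ v) = 0) (hsim : E.Similar d₁ d₂) :
    E.renormalised d₁ = E.renormalised d₂ := by
  obtain ⟨c, hc, hcv⟩ := hsim
  have hr : Real.sqrt c ≠ 0 := (Real.sqrt_pos.2 hc).ne'
  obtain ⟨e, he⟩ := exists_isometry_apply_eq (fun v => Real.sqrt c • d₂ v) d₁ Finset.univ
    (fun u v huv => by
      rw [inner_smul_left, inner_smul_right, inner_eq_formQ, h₂ u v huv]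
      simp)
    (fun u v huv => h₁ u v huv) (fun v => by
      have h : inner ℝ (d₁ v) (d₁ v) = c * inner ℝ (d₂ v) (d₂ v) := hcv v
      rw [real_inner_self_eq_norm_sq, real_inner_self_eq_norm_sq] at h
      rw [norm_smul, Real.norm_of_nonneg (Real.sqrt_nonneg c),
        ← pow_left_inj₀ (by positivity) (by positivity) two_ne_zero, mul_pow, Real.sq_sqrt hc.le, h])
  let τ := similitude (Real.sqrt c) e
  let σ := similitude (Real.sqrt c)⁻¹ e.symm
  have hστ : ∀ ℓ, σ.toLin (τ.toLin ℓ) = ℓ := fun ℓ => by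
    simp only [σ, τ, similitude_apply, map_smul, e.symm_apply_apply]
    rw [smul_inv_smul₀ hr]
  have hτσ : ∀ ℓ, τ.toLin (σ.toLin ℓ) = ℓ := fun ℓ => by
    simp only [σ, τ, similitude_apply, map_smul, e.apply_symm_apply]
    rw [inv_smul_smul₀ hr]
  have hτ : Function.Injective τ.toLin := Function.LeftInverse.injective hστ
  have hσ : Function.Injective σ.toLin := Function.LeftInverse.injective hτσ
  have hd : (fun v => τ.toLin (d₂ v)) = d₁ := funext fun v => by
    rw [similitude_apply, ← map_smul]
    exact he v (Finset.mem_univ v)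
  have hinner : ∀ x y, inner ℝ x y = (0 : ℝ) → inner ℝ (τ.toLin x) (τ.toLin y) = (0 : ℝ) := by
    intro x y hxy
    simp only [τ, similitude_apply, inner_smul_left, inner_smul_right, e.inner_map_map, hxy,
      mul_zero]
  have hpart : ∀ d : V → E.Forms, E.IsHolPart (E.forestR₁ d) (E.piPlus (E.forestR₁ d)) := fun d =>
    Classical.epsilon_spec (E.exists_isHolPart (E.forestR₁ d))
  have key : E.IsHolPart (E.forestR₁ d₁) (τ.pull (E.piPlus (E.forestR₁ d₂))) := by
    have := AdjointPair.pullMer_isHolPart hτ hinner (hpart d₂)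
    rwa [AdjointPair.pullMer_forestR₁ hτ hσ hστ, hd] at this
  rw [renormalised, renormalised, (existsUnique_isHolPart _).unique (hpart d₁) key,
    AdjointPair.evZero_pull]

end InnerForm
end BranchedIntegral
end

/-- Similar properly decorated rooted forests have well-defined renormalised values (the
decomposition that defines `π₊` exists and is unique), and these are equal. -/
theorem corollary5p7 (E : BranchedIntegral.InnerForm) {V : Type*} [Fintype V] [PartialOrder V]
    (hV : BranchedIntegral.IsRootedForest V) (d₁ d₂ : V → E.Forms)
    (h₁ : E.IsProperlyDecorated d₁) (h₂ : E.IsProperlyDecorated d₂)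
    (hsim : E.Similar d₁ d₂) :
    (∃! g, E.IsHolPart (E.forestR₁ d₁) g) ∧
    (∃! g, E.IsHolPart (E.forestR₁ d₂) g) ∧
    E.renormalised d₁ = E.renormalised d₂ := by
  exact ⟨BranchedIntegral.InnerForm.existsUnique_isHolPart _,
    BranchedIntegral.InnerForm.existsUnique_isHolPart _,
    BranchedIntegral.InnerForm.renormalised_eq_of_similar h₁.orthogonal h₂.orthogonal hsim⟩
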